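/- Let $k\ge 0$ and let $\Lambda$ be a finite $k$-graph with no sources, i.e. a countable small category with a degree functor $d:\Lambda\to\mathbb N^k$ having the unique factorization property, such that $\Lambda^n=d^{-1}(n)$ is finite for every $n\in\mathbb N^k$ and $v\Lambda^n=\{\lambda\in\Lambda^n : r(\lambda)=v\}\neq\emptyset$ for every $v\in\Lambda^0$, $n\in\mathbb N^k$. Let $C^*(\Lambda)$ be the $C^*$-algebra generated by a universal Cuntz--Krieger $\Lambda$-family $\{s_\lambda:\lambda\in\Lambda\}$, i.e. partial isometries such that the $s_v$ ($v\in\Lambda^0$) are mutually orthogonal projections, $s_\lambda s_\nu=s_{\lambda\nu}$ when $s(\lambda)=r(\nu)$, $s_\lambda^*s_\lambda=s_{s(\lambda)}$, and $s_v=\sum_{\lambda\in v\Lambda^n}s_\lambda s_\lambda^*$ for all $v\in\Lambda^0$, $n\in\mathbb N^k$. Let $\gamma$ be the gauge action of $\mathbb T^k$ on $C^*(\Lambda)$, $\gamma_z(s_\lambda)=z^{d(\lambda)}s_\lambda$. A finite family of measurable maps $\sigma_i:D_i\to X$ on measurable subsets $D_i$ of a measure space $(X,\mu)$ is a semibranching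 function system if the sets $R_i=\sigma_i(D_i)$ are $\mu$-measurable, $\mu(X\setminus\bigcup_iR_i)=0$, $\mu(R_i\cap R_j)=0$ for $i\ne j$, and for each $i$ there is a Radon--Nikodym derivative $\Phi_{\sigma_i}=d(\mu\circ\sigma_i)/d\mu$ on $D_i$ (that is, $\mu(\sigma_i(E))=\int_E\Phi_{\sigma_i}\,d\mu$ for all measurable $E\subseteq D_i$) with $\Phi_{\sigma_i}>0$ a.e. on $D_i$. A coding map for the family is a measurable $\sigma:X\to X$ with $\sigma(\sigma_i(x))=x$ for all $i$ and all $x\in D_i$. A $\Lambda$-semibranching function system on $(X,\mu)$ consists of measurable sets $D_\lambda\subseteq X$, prefixing maps $\tau_\lambda:D_\lambda\to X$ $(\lambda\in\Lambda)$ and coding maps $\tau^m:X\to X$ $(m\in\mathbb N^k)$ such that, with $R_\lambda=\tau_\lambda(D_\lambda)$: (a) for each $m\in\mathbb N^k$, $\{\tau_\lambda:d(\lambda)=m\}$ is a semibranching function system with coding map $\tau^m$; (b) for each $v\in\Lambda^0$, $\tau_v=\mathrm{id}$ on $D_v$ and $\mu(D_v)>0$; (c) whenever $s(\lambda)=r(\nu)$,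 up to null sets $R_\nu\subseteq D_\lambda$ and $D_{\lambda\nu}=D_\nu$, and $\tau_\lambda\circ\tau_\nu=\tau_{\lambda\nu}$ almost everywhere on $D_\nu$; (d) $\tau^m\circ\tau^n=\tau^{m+n}$ for all $m,n\in\mathbb N^k$. Theorem. Suppose that a $\Lambda$-semibranching function system on a probability space $(X,\mu)$ is given, and that there are $\omega\in(0,\infty)$ and $C=(C_1,\dots,C_k)\in(0,\infty)^k$ such that, for every $\lambda\in\Lambda$, the Radon--Nikodym derivative of $\mu\circ\tau_\lambda$ with respect to $\mu$ on $D_\lambda$ is the constant $$\Phi_{\tau_\lambda}=C^{-\omega d(\lambda)}=\prod_{i=1}^kC_i^{-\omega d(\lambda)_i}.$$ Let $\alpha$ be the dynamics on $C^*(\Lambda)$ given by $\alpha_t=\gamma_{C^{it}}$, where $C^{it}=(C_1^{it},\dots,C_k^{it})$. Then there is a unique continuous linear functional $\phi$ on $C^*(\Lambda)$ such that $$\phi(s_\lambda s_\nu^*)=\delta_{\lambda,\nu}\,\mu(R_\lambda)\qquad\text{for all }\lambda,\nu\in\Lambda,$$ and $\phi$ is a KMS state of $(C^*(\Lambda),\alpha)$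 at inverse temperature $\omega$: it is a state, and $\phi(ab)=\phi(b\,\alpha_{i\omega}(a))$ for all $a,b\in C^*(\Lambda)$ that are analytic for $\alpha$, meaning that $t\mapsto\alpha_t(a)$ extends to an entire function $z\mapsto\alpha_z(a)$, and likewise for $b$. -/

import Mathlib

open scoped ENNReal
open CategoryTheory MeasureTheory

universe u

/-! ### Higher-rank graphs -/

/-- A `k`-graph: a countable small category with object set `V`, together with a degree functor to
`ℕ^k` having the unique factorization property.  A morphism `f : w ⟶ v` is a path with source `w`
and range `v`, and the path usually written `μν` (defined when the source of `μ` is the range of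
`ν`) is `ν ≫ μ` in Mathlib's notation. -/
structure KGraph (k : ℕ) (V : Type u) [SmallCategory V] where
  d : ∀ {w v : V}, (w ⟶ v) → (Fin k → ℕ)
  d_id : ∀ v : V, d (𝟙 v) = 0
  d_comp : ∀ {u w v : V} (ν : u ⟶ w) (μ : w ⟶ v), d (ν ≫ μ) = d μ + d ν
  factorization : ∀ {u v : V} (lam : u ⟶ v) (m n : Fin k → ℕ), d lam = m + n →
    ∃! p : Σ w : V, (u ⟶ w) × (w ⟶ v), p.2.1 ≫ p.2.2 = lam ∧ d p.2.2 = m ∧ d p.2.1 = n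
  countable_morphisms : Countable (Σ w : V, Σ v : V, (w ⟶ v))

namespace KGraph

variable {k : ℕ} {V : Type u} [SmallCategory V]

/-- The set of all (finite) paths of a `k`-graph, that is, the set of all morphisms. -/
structure Path (Λ : KGraph k V) where
  {s : V}
  {r : V}
  hom : s ⟶ r

/-- The degree of a path. -/
def degree (Λ : KGraph k V) (p : Λ.Path) : Fin k → ℕ := Λ.d p.hom

/-- The vertex `v` as a path, i.e. the identity morphism at `v`. -/
def vertex (Λ : KGraph k V) (v : V) : Λ.Path := ⟨𝟙 v⟩

/-- `Λ` is finite if there are only finitely many paths of each degree. -/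
class IsFinite (Λ : KGraph k V) : Prop where
  finite_degree : ∀ n : Fin k → ℕ, {p : Λ.Path | Λ.degree p = n}.Finite

/-- `Λ` has no sources: every vertex receives a path of every degree. -/
def NoSources (Λ : KGraph k V) : Prop :=
  ∀ (v : V) (n : Fin k → ℕ), ∃ p : Λ.Path, p.r = v ∧ Λ.degree p = n

theorem finite_into (Λ : KGraph k V) [Λ.IsFinite] (v : V) (n : Fin k → ℕ) :
    {p : Λ.Path | p.r = v ∧ Λ.degree p = n}.Finite :=
  (IsFinite.finite_degree n).subset fun _ hp => hp.2

/-- The finite set `vΛ^n` of paths with range `v` and degree `n`. -/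
noncomputable def into (Λ : KGraph k V) [Λ.IsFinite] (v : V) (n : Fin k → ℕ) : Finset Λ.Path :=
  (Λ.finite_into v n).toFinset

theorem mem_into (Λ : KGraph k V) [Λ.IsFinite] (v : V) (n : Fin k → ℕ) (p : Λ.Path) :
    p ∈ Λ.into v n ↔ p.r = v ∧ Λ.degree p = n := by
  simp [into]

/-! ### Cuntz-Krieger families and the C*-algebra of a `k`-graph -/

/-- A Cuntz-Krieger `Λ`-family in a C*-algebra `B`. -/
structure CKFamily (Λ : KGraph k V) [Λ.IsFinite] (B : Type*) [NonUnitalCStarAlgebra B] where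
  t : Λ.Path → B
  partialIsometry : ∀ p, t p * star (t p) * t p = t p
  vertex_proj : ∀ v : V, IsStarProjection (t (Λ.vertex v))
  vertex_orthogonal : ∀ v w : V, v ≠ w → t (Λ.vertex v) * t (Λ.vertex w) = 0
  mul : ∀ {u w v : V} (μ : w ⟶ v) (ν : u ⟶ w), t ⟨μ⟩ * t ⟨ν⟩ = t ⟨ν ≫ μ⟩
  star_mul_self : ∀ p, star (t p) * t p = t (Λ.vertex p.s)
  sum_range : ∀ (v : V) (n : Fin k → ℕ),
    t (Λ.vertex v) = ∑ p ∈ Λ.into v n, t p * star (t p)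

theorem CKFamily.norm_le_one {Λ : KGraph k V} [Λ.IsFinite] {B : Type*} [NonUnitalCStarAlgebra B]
    (T : CKFamily Λ B) (p : Λ.Path) : ‖T.t p‖ ≤ 1 := by
  have h1 : ‖T.t p‖ * ‖T.t p‖ ≤ 1 := by
    rw [← CStarRing.norm_star_mul_self, T.star_mul_self]
    exact (T.vertex_proj _).norm_le
  nlinarith [norm_nonneg (T.t p)]

/-- A Cuntz-Krieger `Λ`-family together with the C*-algebra in which it lives. -/
structure CKRep (Λ : KGraph k V) [Λ.IsFinite] where
  B : Type u
  [inst : NonUnitalCStarAlgebra B]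
  fam : CKFamily Λ B

attribute [instance] CKRep.inst

/-- The C*-algebra of bounded elements in the product over all Cuntz-Krieger `Λ`-families. -/
abbrev BigProd (Λ : KGraph k V) [Λ.IsFinite] : Type (u + 1) :=
  lp (fun i : CKRep Λ => i.B) ∞

/-- The element of the product whose coordinates are the `p`-th members of all families. -/
noncomputable def bigGen (Λ : KGraph k V) [Λ.IsFinite] (p : Λ.Path) : BigProd Λ :=
  ⟨fun i => i.fam.t p, memℓp_infty ⟨1, by rintro _ ⟨i, rfl⟩; exact i.fam.norm_le_one p⟩⟩

/-- The closed *-subalgebra generated by the product of all Cuntz-Krieger `Λ`-families. -/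
noncomputable def cstarSubalgebra (Λ : KGraph k V) [Λ.IsFinite] :
    NonUnitalStarSubalgebra ℂ (BigProd Λ) :=
  (NonUnitalStarAlgebra.adjoin ℂ (Set.range Λ.bigGen)).topologicalClosure

instance isClosed_cstarSubalgebra (Λ : KGraph k V) [Λ.IsFinite] :
    IsClosed (Λ.cstarSubalgebra : Set (BigProd Λ)) :=
  NonUnitalStarSubalgebra.isClosed_topologicalClosure _

/-- The Cuntz-Krieger C*-algebra `C*(Λ)`: the C*-algebra generated by a universal Cuntz-Krieger
`Λ`-family.  See `gen` for the universal family and `lift_gen` for its universal property. -/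
abbrev CStar (Λ : KGraph k V) [Λ.IsFinite] : Type (u + 1) := Λ.cstarSubalgebra

theorem bigGen_mem (Λ : KGraph k V) [Λ.IsFinite] (p : Λ.Path) :
    Λ.bigGen p ∈ Λ.cstarSubalgebra :=
  NonUnitalStarSubalgebra.le_topologicalClosure _
    (NonUnitalStarAlgebra.subset_adjoin ℂ _ ⟨p, rfl⟩)

/-- The generator `s_p` of `C*(Λ)`. -/
noncomputable def gen (Λ : KGraph k V) [Λ.IsFinite] (p : Λ.Path) : Λ.CStar :=
  ⟨Λ.bigGen p, Λ.bigGen_mem p⟩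

/-- The *-homomorphism from `C*(Λ)` determined by a Cuntz-Krieger `Λ`-family. -/
noncomputable def lift (Λ : KGraph k V) [Λ.IsFinite] (i : CKRep Λ) : Λ.CStar →⋆ₙₐ[ℂ] i.B where
  toFun a := (a : BigProd Λ) i
  map_smul' _ _ := rfl
  map_zero' := rfl
  map_add' _ _ := rfl
  map_mul' _ _ := rfl
  map_star' _ := rfl

theorem lift_gen (Λ : KGraph k V) [Λ.IsFinite] (i : CKRep Λ) (p : Λ.Path) :
    Λ.lift i (Λ.gen p) = i.fam.t p := rfl

theorem CStar.ext_lift {Λ : KGraph k V} [Λ.IsFinite] {a b : Λ.CStar}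
    (h : ∀ i, Λ.lift i a = Λ.lift i b) : a = b :=
  Subtype.ext (lp.ext (funext h))

/-- The generators of `C*(Λ)` form a Cuntz-Krieger `Λ`-family. -/
noncomputable def genFamily (Λ : KGraph k V) [Λ.IsFinite] : CKFamily Λ Λ.CStar where
  t := Λ.gen
  partialIsometry p := CStar.ext_lift fun i => by
    simp only [map_mul, map_star, lift_gen, i.fam.partialIsometry]
  vertex_proj v :=
    ⟨CStar.ext_lift fun i => by
      rw [map_mul, lift_gen]; exact (i.fam.vertex_proj v).isIdempotentElem,
     CStar.ext_lift fun i => by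
      rw [map_star, lift_gen]; exact (i.fam.vertex_proj v).isSelfAdjoint⟩
  vertex_orthogonal v w h := CStar.ext_lift fun i => by
    simp only [map_mul, map_zero, lift_gen, i.fam.vertex_orthogonal v w h]
  mul μ ν := CStar.ext_lift fun i => by
    simp only [map_mul, lift_gen, i.fam.mul]
  star_mul_self p := CStar.ext_lift fun i => by
    simp only [map_mul, map_star, lift_gen, i.fam.star_mul_self]
  sum_range v n := CStar.ext_lift fun i => by
    simp only [map_sum, map_mul, map_star, lift_gen]
    exact i.fam.sum_range v n

/-! ### The gauge action -/

/-- `z^n = ∏ z_i^{n_i}` for `z` in the `k`-torus. -/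
noncomputable def torusPow (z : Fin k → Circle) (n : Fin k → ℕ) : Circle := ∏ i, z i ^ n i

theorem torusPow_add (z : Fin k → Circle) (m n : Fin k → ℕ) :
    torusPow z (m + n) = torusPow z m * torusPow z n := by
  simp [torusPow, pow_add, Finset.prod_mul_distrib]

theorem torusPow_mul (z w : Fin k → Circle) (n : Fin k → ℕ) :
    torusPow (z * w) n = torusPow z n * torusPow w n := by
  simp [torusPow, mul_pow, Finset.prod_mul_distrib]

theorem torusPow_one (n : Fin k → ℕ) : torusPow (1 : Fin k → Circle) n = 1 := by
  simp [torusPow]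

theorem star_torusPow_mul_self (z : Fin k → Circle) (n : Fin k → ℕ) :
    star (torusPow z n : ℂ) * (torusPow z n : ℂ) = 1 := by
  rw [RCLike.star_def, mul_comm, Complex.mul_conj, Circle.normSq_coe, Complex.ofReal_one]

theorem torusPow_vertex {Λ : KGraph k V} (z : Fin k → Circle) (v : V) :
    (torusPow z (Λ.degree (Λ.vertex v)) : ℂ) = 1 := by
  simp [degree, vertex, Λ.d_id, torusPow]

/-- The Cuntz-Krieger family `p ↦ z^{d(p)} t_p`. -/
noncomputable def CKFamily.twist {Λ : KGraph k V} [Λ.IsFinite] {B : Type*}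
    [NonUnitalCStarAlgebra B] (T : CKFamily Λ B) (z : Fin k → Circle) : CKFamily Λ B where
  t p := (torusPow z (Λ.degree p) : ℂ) • T.t p
  partialIsometry p := by
    simp only [star_smul, smul_mul_assoc, mul_smul_comm, smul_smul, T.partialIsometry,
      star_torusPow_mul_self, mul_one]
  vertex_proj v := by rw [torusPow_vertex, one_smul]; exact T.vertex_proj v
  vertex_orthogonal v w h := by
    rw [torusPow_vertex, torusPow_vertex, one_smul, one_smul]; exact T.vertex_orthogonal v w h
  mul μ ν := by
    simp only [smul_mul_assoc, mul_smul_comm, smul_smul, T.mul, degree, Λ.d_comp, torusPow_add,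
      Circle.coe_mul]
    rw [mul_comm]
  star_mul_self p := by
    rw [torusPow_vertex, one_smul, star_smul, smul_mul_assoc, mul_smul_comm, smul_smul,
      star_torusPow_mul_self, one_smul, T.star_mul_self]
  sum_range v n := by
    rw [torusPow_vertex, one_smul, T.sum_range v n]
    refine Finset.sum_congr rfl fun p _ => ?_
    rw [star_smul, smul_mul_assoc, mul_smul_comm, smul_smul, mul_comm, star_torusPow_mul_self,
      one_smul]

/-- Twisting all families by `z`. -/
noncomputable def CKRep.twist {Λ : KGraph k V} [Λ.IsFinite] (z : Fin k → Circle) (i : CKRep Λ) :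
    CKRep Λ where
  B := i.B
  inst := i.inst
  fam := i.fam.twist z

/-- The *-endomorphism of the product which permutes the coordinates by twisting. -/
noncomputable def bigGauge (Λ : KGraph k V) [Λ.IsFinite] (z : Fin k → Circle) :
    BigProd Λ →⋆ₙₐ[ℂ] BigProd Λ where
  toFun a := ⟨fun i => a (i.twist z), memℓp_infty (by
    obtain ⟨c, hc⟩ := memℓp_infty_iff.1 (lp.memℓp a)
    exact ⟨c, by rintro _ ⟨i, rfl⟩; exact hc ⟨i.twist z, rfl⟩⟩)⟩
  map_smul' _ _ := rfl
  map_zero' := rfl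
  map_add' _ _ := rfl
  map_mul' _ _ := rfl
  map_star' _ := rfl

theorem bigGauge_apply (Λ : KGraph k V) [Λ.IsFinite] (z : Fin k → Circle) (a : BigProd Λ)
    (i : CKRep Λ) : Λ.bigGauge z a i = a (i.twist z) := rfl

theorem bigGauge_bigGen (Λ : KGraph k V) [Λ.IsFinite] (z : Fin k → Circle) (p : Λ.Path) :
    Λ.bigGauge z (Λ.bigGen p) = (torusPow z (Λ.degree p) : ℂ) • Λ.bigGen p := rfl

theorem continuous_bigGauge (Λ : KGraph k V) [Λ.IsFinite] (z : Fin k → Circle) :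
    Continuous (Λ.bigGauge z) := by
  refine AddMonoidHomClass.continuous_of_bound (Λ.bigGauge z) 1 fun a => ?_
  rw [one_mul]
  exact lp.norm_le_of_forall_le (norm_nonneg a) fun i =>
    lp.norm_apply_le_norm ENNReal.top_ne_zero a (i.twist z)

theorem bigGauge_mem (Λ : KGraph k V) [Λ.IsFinite] (z : Fin k → Circle) {a : BigProd Λ}
    (ha : a ∈ Λ.cstarSubalgebra) : Λ.bigGauge z a ∈ Λ.cstarSubalgebra := by
  have h : Λ.cstarSubalgebra ≤ NonUnitalStarSubalgebra.comap (Λ.bigGauge z) Λ.cstarSubalgebra := by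
    refine NonUnitalStarSubalgebra.topologicalClosure_minimal _ ?_
      (Λ.isClosed_cstarSubalgebra.preimage (Λ.continuous_bigGauge z))
    refine NonUnitalStarAlgebra.adjoin_le ?_
    rintro _ ⟨p, rfl⟩
    change Λ.bigGauge z (Λ.bigGen p) ∈ Λ.cstarSubalgebra
    rw [bigGauge_bigGen]
    exact SMulMemClass.smul_mem _ (Λ.bigGen_mem p)
  exact h ha

theorem CKFamily.twist_twist {Λ : KGraph k V} [Λ.IsFinite] {B : Type*}
    [NonUnitalCStarAlgebra B] (T : CKFamily Λ B) (z w : Fin k → Circle) :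
    (T.twist z).twist w = T.twist (z * w) := by
  simp only [CKFamily.twist, CKFamily.mk.injEq]
  funext p
  rw [smul_smul, torusPow_mul, Circle.coe_mul, mul_comm]

theorem CKFamily.twist_one {Λ : KGraph k V} [Λ.IsFinite] {B : Type*}
    [NonUnitalCStarAlgebra B] (T : CKFamily Λ B) : T.twist 1 = T := by
  obtain ⟨t, _⟩ := T
  simp only [CKFamily.twist, CKFamily.mk.injEq]
  funext p
  rw [torusPow_one, Circle.coe_one, one_smul]

theorem bigGauge_bigGauge (Λ : KGraph k V) [Λ.IsFinite] (z w : Fin k → Circle) (a : BigProd Λ) :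
    Λ.bigGauge z (Λ.bigGauge w a) = Λ.bigGauge (z * w) a := by
  refine lp.ext (funext fun i => ?_)
  have key : ∀ f g : CKFamily Λ i.B, f = g →
      (a (CKRep.mk i.B f) : i.B) = a (CKRep.mk i.B g) := by
    rintro f _ rfl; rfl
  exact key _ _ (i.fam.twist_twist z w)

theorem bigGauge_one (Λ : KGraph k V) [Λ.IsFinite] (a : BigProd Λ) : Λ.bigGauge 1 a = a := by
  refine lp.ext (funext fun i => ?_)
  have key : ∀ f g : CKFamily Λ i.B, f = g →
      (a (CKRep.mk i.B f) : i.B) = a (CKRep.mk i.B g) := by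
    rintro f _ rfl; rfl
  exact key _ _ i.fam.twist_one

/-- The automorphism `γ_z` of `C*(Λ)`. -/
noncomputable def gaugeAut (Λ : KGraph k V) [Λ.IsFinite] (z : Fin k → Circle) :
    Λ.CStar ≃⋆ₐ[ℂ] Λ.CStar where
  toFun a := ⟨Λ.bigGauge z a, Λ.bigGauge_mem z a.2⟩
  invFun a := ⟨Λ.bigGauge z⁻¹ a, Λ.bigGauge_mem z⁻¹ a.2⟩
  left_inv a := Subtype.ext (by
    change Λ.bigGauge z⁻¹ (Λ.bigGauge z a) = a
    rw [bigGauge_bigGauge, inv_mul_cancel, bigGauge_one])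
  right_inv a := Subtype.ext (by
    change Λ.bigGauge z (Λ.bigGauge z⁻¹ a) = a
    rw [bigGauge_bigGauge, mul_inv_cancel, bigGauge_one])
  map_smul' _ _ := rfl
  map_add' _ _ := rfl
  map_mul' _ _ := rfl
  map_star' _ := rfl

/-- The gauge action `γ` of the `k`-torus on `C*(Λ)`. -/
noncomputable def gauge (Λ : KGraph k V) [Λ.IsFinite] :
    (Fin k → Circle) →* (Λ.CStar ≃⋆ₐ[ℂ] Λ.CStar) where
  toFun := Λ.gaugeAut
  map_one' := StarAlgEquiv.ext fun a => Subtype.ext (Λ.bigGauge_one a)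
  map_mul' z w := StarAlgEquiv.ext fun a => Subtype.ext (Λ.bigGauge_bigGauge z w a).symm

/-- The gauge action is characterised by `γ_z(s_p) = z^{d(p)} s_p`. -/
theorem gauge_gen (Λ : KGraph k V) [Λ.IsFinite] (z : Fin k → Circle) (p : Λ.Path) :
    Λ.gauge z (Λ.gen p) = (torusPow z (Λ.degree p) : ℂ) • Λ.gen p := rfl

/-- The dynamics `α_t = γ_{C^{it}}` on `C*(Λ)`, where `C^{it} = (C_1^{it}, …, C_k^{it})` and
`c^{it} = exp (i t log c)` for `c > 0`. -/
noncomputable def dynamics (Λ : KGraph k V) [Λ.IsFinite] (C : Fin k → ℝ) (t : ℝ) :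
    Λ.CStar ≃⋆ₐ[ℂ] Λ.CStar :=
  Λ.gauge fun i => Circle.exp (t * Real.log (C i))

end KGraph

/-! ### States and the KMS condition -/

/-- A state of a C*-algebra: a positive linear functional of norm one. -/
def IsCStarState {A : Type*} [NonUnitalCStarAlgebra A] (φ : A →L[ℂ] ℂ) : Prop :=
  (∀ a : A, 0 ≤ (φ (star a * a)).re ∧ (φ (star a * a)).im = 0) ∧ ‖φ‖ = 1

/-- `F` is an entire function extending `t ↦ α_t(a)`. -/
def IsEntireExtension {A : Type*} [NonUnitalCStarAlgebra A] (α : ℝ → (A ≃⋆ₐ[ℂ] A)) (a : A)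
    (F : ℂ → A) : Prop :=
  Differentiable ℂ F ∧ ∀ t : ℝ, F t = α t a

/-- `φ` is a KMS state at inverse temperature `β` for the dynamics `α`: it is a state, and
`φ(ab) = φ(b α_{iβ}(a))` for all analytic elements `a`, `b`. -/
def IsKMSState {A : Type*} [NonUnitalCStarAlgebra A] (α : ℝ → (A ≃⋆ₐ[ℂ] A)) (β : ℝ)
    (φ : A →L[ℂ] ℂ) : Prop :=
  IsCStarState φ ∧
    ∀ (a b : A) (F G : ℂ → A), IsEntireExtension α a F → IsEntireExtension α b G →
      φ (a * b) = φ (b * F (Complex.I * β))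

/-! ### Semibranching function systems -/

/-- `Φ` is a Radon-Nikodym derivative `d(μ ∘ σ)/dμ` on `D`, where `μ ∘ σ` is the set function
`E ↦ μ (σ(E))` on the measurable subsets `E` of `D`. -/
def IsRNDerivOn {X : Type*} [MeasurableSpace X] (μ : Measure X) (D : Set X) (σ : X → X)
    (Φ : X → ℝ≥0∞) : Prop :=
  AEMeasurable Φ (μ.restrict D) ∧
    ∀ E : Set X, MeasurableSet E → E ⊆ D → μ (σ '' E) = ∫⁻ x in E, Φ x ∂μ

/-- A finite family of maps `σ_i : D_i → X` is a semibranching function system on `(X, μ)`.  Only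
the values of `σ i` on `D i` matter. -/
structure IsSemibranching {X : Type*} [MeasurableSpace X] (μ : Measure X) {ι : Type*}
    (D : ι → Set X) (σ : ι → X → X) : Prop where
  finite_index : Finite ι
  measurable_domain : ∀ i, MeasurableSet (D i)
  measurable_map : ∀ i, Measurable ((D i).domRestrict (σ i))
  measurable_range : ∀ i, NullMeasurableSet (σ i '' D i) μ
  cover : μ (⋃ i, σ i '' D i)ᶜ = 0
  disjoint : ∀ i j, i ≠ j → μ (σ i '' D i ∩ σ j '' D j) = 0
  rnDeriv : ∀ i, ∃ Φ : X → ℝ≥0∞, IsRNDerivOn μ (D i) (σ i) Φ ∧ ∀ᵐ x ∂μ.restrict (D i), 0 < Φ x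

/-- `c` is a coding map for the family `σ_i : D_i → X`. -/
def IsCodingMap {X : Type*} [MeasurableSpace X] {ι : Type*} (D : ι → Set X) (σ : ι → X → X)
    (c : X → X) : Prop :=
  Measurable c ∧ ∀ i, ∀ x ∈ D i, c (σ i x) = x

/-- A `Λ`-semibranching function system on `(X, μ)`, with prefixing maps `τ_p : D_p → X` (only the
values of `τ p` on `D p` matter) and coding maps `τ^m`, here `code m`. -/
structure KGraph.SemibranchingSystem {k : ℕ} {V : Type u} [SmallCategory V] (Λ : KGraph k V)
    {X : Type*} [MeasurableSpace X] (μ : Measure X) where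
  D : Λ.Path → Set X
  τ : Λ.Path → X → X
  code : (Fin k → ℕ) → X → X
  semibranching : ∀ m : Fin k → ℕ,
    IsSemibranching μ (fun p : {p : Λ.Path // Λ.degree p = m} => D p) (fun p => τ p)
  coding : ∀ m : Fin k → ℕ,
    IsCodingMap (fun p : {p : Λ.Path // Λ.degree p = m} => D p) (fun p => τ p) (code m)
  vertex_id : ∀ v : V, ∀ x ∈ D (Λ.vertex v), τ (Λ.vertex v) x = x
  vertex_pos : ∀ v : V, 0 < μ (D (Λ.vertex v))
  range_subset : ∀ {u w v : V} (lam : w ⟶ v) (ν : u ⟶ w),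
    τ ⟨ν⟩ '' D ⟨ν⟩ ≤ᵐ[μ] D ⟨lam⟩
  /- The partial maps `τ_lam ∘ τ_ν`, defined almost everywhere on `D_ν`, and `τ_{lam ν}` agree almost
  everywhere: their domains agree up to a null set, and so do their values. -/
  domain_comp : ∀ {u w v : V} (lam : w ⟶ v) (ν : u ⟶ w), D ⟨ν ≫ lam⟩ =ᵐ[μ] D ⟨ν⟩
  comp : ∀ {u w v : V} (lam : w ⟶ v) (ν : u ⟶ w),
    ∀ᵐ x ∂μ, x ∈ D ⟨ν⟩ → τ ⟨lam⟩ (τ ⟨ν⟩ x) = τ ⟨ν ≫ lam⟩ x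
  code_comp : ∀ m n : Fin k → ℕ, code m ∘ code n = code (m + n)

/-- The range `R_p = τ_p(D_p)`. -/
def KGraph.SemibranchingSystem.R {k : ℕ} {V : Type u} [SmallCategory V] {Λ : KGraph k V}
    {X : Type*} [MeasurableSpace X] {μ : Measure X} (S : Λ.SemibranchingSystem μ)
    (p : Λ.Path) : Set X :=
  S.τ p '' S.D p

/-! The weights `w(λ) = μ(R_λ)` carry all the measure theory. Almost everywhere the sets `R_λ` with
`d(λ) = n` partition `X`, and those with range `v` partition `D_v`. Together with the constant
derivative this gives `w(λν) = C^{-ω d(λ)} w(ν)`, the consistency relation `w(λ) = ∑ w(λη)` over `η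
∈ s(λ)Λ^n`, and total mass one in each degree. What remains concerns `C*(Λ)` alone.

Uniqueness: the monomials `s_λ s_ν^*` span a dense *-subalgebra, because the Cuntz-Krieger sum can
lengthen `ν` until a product of two monomials collapses (`dense_monomialSpan`).

Existence: represent `C*(Λ)` on `ℓ²` of pairs (infinite path, element of `ℤ^k`), where `s_λ`
prefixes `λ` and adds `d(λ)` to the grading. By the grading, the vector functional at `(y, 0)` sends
`s_λ s_ν^*` to `1` if `λ = ν` is an initial segment of `y`, and to `0` otherwise, even when `y` is
periodic. Placing mass `w(λ)` on one infinite path beginning with `λ`, for each `λ` of degree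
`(j,…,j)`, gives a positive functional whose value on a fixed monomial is correct once `j` is large.
A weak-* limit point is `φ` (`exists_functional_of_weight`). Infinite paths are germs along an
ultrafilter, which chooses initial segments out of finite sets.

KMS: the scaling of `w` gives `φ(s_λ b) = C^{-ω d(λ)} φ(b s_λ)`, hence by adjoints a twisted trace
identity for every monomial (`IsDiagonal.map_monomial_mul`). For an analytic `a`, gauge invariance
of `φ` and the identity theorem turn this into the KMS condition against monomials
(`IsDiagonal.map_mul_entireExtension`), and density finishes. -/

namespace KGraph

variable {k : ℕ} {V : Type u} [SmallCategory V]

/-! ### Concatenation of paths -/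

open scoped Classical in
/-- The path `pq`, with the junk value `p` when the source of `p` is not the range of `q`. -/
noncomputable def Path.append {Λ : KGraph k V} (p q : Λ.Path) : Λ.Path :=
  if h : q.r = p.s then ⟨q.hom ≫ eqToHom h ≫ p.hom⟩ else p

namespace Path

variable {Λ : KGraph k V}

theorem append_mk {u w v : V} (μ : w ⟶ v) (ν : u ⟶ w) :
    append (⟨μ⟩ : Λ.Path) ⟨ν⟩ = ⟨ν ≫ μ⟩ := by
  simp [append]

theorem append_s {p q : Λ.Path} (h : q.r = p.s) : (p.append q).s = q.s := by
  simp [append, h]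

theorem append_r {p q : Λ.Path} (h : q.r = p.s) : (p.append q).r = p.r := by
  simp [append, h]

theorem degree_append {p q : Λ.Path} (h : q.r = p.s) :
    Λ.degree (p.append q) = Λ.degree p + Λ.degree q := by
  obtain ⟨f⟩ := p
  obtain ⟨g⟩ := q
  obtain rfl : _ = _ := h
  rw [append_mk]
  exact Λ.d_comp g f

theorem append_assoc {p q e : Λ.Path} (h : q.r = p.s) (h' : e.r = q.s) :
    (p.append q).append e = p.append (q.append e) := by
  obtain ⟨f⟩ := p
  obtain ⟨g⟩ := q
  obtain ⟨l⟩ := e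
  obtain rfl : _ = _ := h
  obtain rfl : _ = _ := h'
  simp only [append_mk, Category.assoc]

theorem vertex_append {p : Λ.Path} {v : V} (h : p.r = v) : (Λ.vertex v).append p = p := by
  obtain ⟨f⟩ := p
  obtain rfl : _ = _ := h
  simp [vertex, append_mk]

theorem append_vertex {p : Λ.Path} {v : V} (h : p.s = v) : p.append (Λ.vertex v) = p := by
  obtain ⟨f⟩ := p
  obtain rfl : _ = _ := h
  simp [vertex, append_mk]

theorem degree_vertex (v : V) : Λ.degree (Λ.vertex v) = 0 := Λ.d_id v

theorem exists_eq_append {p : Λ.Path} {m n : Fin k → ℕ} (h : Λ.degree p = m + n) :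
    ∃ a b : Λ.Path, b.r = a.s ∧ a.append b = p ∧ Λ.degree a = m ∧ Λ.degree b = n := by
  obtain ⟨f⟩ := p
  obtain ⟨⟨w, g, l⟩, ⟨h1, h2, h3⟩, -⟩ := Λ.factorization f m n h
  exact ⟨⟨l⟩, ⟨g⟩, rfl, by rw [append_mk, h1], h2, h3⟩

theorem exists_eq_append_of_le {p : Λ.Path} {m : Fin k → ℕ} (h : m ≤ Λ.degree p) :
    ∃ a b : Λ.Path, b.r = a.s ∧ a.append b = p ∧ Λ.degree a = m ∧
      Λ.degree b = Λ.degree p - m :=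
  exists_eq_append (add_tsub_cancel_of_le h).symm

theorem append_inj {a b a' b' : Λ.Path} (h : b.r = a.s) (h' : b'.r = a'.s)
    (hd : Λ.degree a = Λ.degree a') (he : a.append b = a'.append b') : a = a' ∧ b = b' := by
  have hd' : Λ.degree b = Λ.degree b' := by
    have := congrArg Λ.degree he
    rw [degree_append h, degree_append h', hd] at this
    exact add_left_cancel this
  obtain ⟨f⟩ := a
  obtain ⟨g⟩ := b
  obtain ⟨f'⟩ := a'
  obtain ⟨g'⟩ := b'
  obtain rfl : _ = _ := h
  obtain rfl : _ = _ := h'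
  rw [append_mk, append_mk, Path.mk.injEq] at he
  obtain ⟨rfl, rfl, he⟩ := he
  have he := eq_of_heq he
  have := (Λ.factorization (g ≫ f) (Λ.d f) (Λ.d g) (Λ.d_comp g f)).unique
    (y₁ := ⟨_, g, f⟩) (y₂ := ⟨_, g', f'⟩) ⟨rfl, rfl, rfl⟩ ⟨he.symm, hd.symm, hd'.symm⟩
  obtain ⟨rfl, h2⟩ := Sigma.mk.inj this
  obtain ⟨rfl, rfl⟩ := Prod.mk.inj (eq_of_heq h2)
  exact ⟨rfl, rfl⟩

theorem vertex_injective : Function.Injective Λ.vertex := fun _ _ h => congrArg Path.r h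

end Path

/-- The finite set `Λ^n` of paths of degree `n`. -/
noncomputable def ofDegree (Λ : KGraph k V) [Λ.IsFinite] (n : Fin k → ℕ) : Finset Λ.Path :=
  (IsFinite.finite_degree n).toFinset

theorem mem_ofDegree (Λ : KGraph k V) [Λ.IsFinite] (n : Fin k → ℕ) (p : Λ.Path) :
    p ∈ Λ.ofDegree n ↔ Λ.degree p = n := by
  simp [ofDegree]

/-! ### Relations in a Cuntz-Krieger family -/

namespace CKFamily

variable {Λ : KGraph k V} [Λ.IsFinite] {B : Type*} [NonUnitalCStarAlgebra B] (T : CKFamily Λ B)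

theorem mul_append {p q : Λ.Path} (h : q.r = p.s) : T.t p * T.t q = T.t (p.append q) := by
  obtain ⟨f⟩ := p
  obtain ⟨g⟩ := q
  obtain rfl : _ = _ := h
  rw [Path.append_mk, T.mul]

theorem mul_vertex (p : Λ.Path) : T.t p * T.t (Λ.vertex p.s) = T.t p := by
  rw [T.mul_append rfl, Path.append_vertex rfl]

theorem vertex_mul (p : Λ.Path) : T.t (Λ.vertex p.r) * T.t p = T.t p := by
  rw [T.mul_append rfl, Path.vertex_append rfl]

theorem star_vertex (v : V) : star (T.t (Λ.vertex v)) = T.t (Λ.vertex v) :=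
  (T.vertex_proj v).isSelfAdjoint

theorem mul_eq_zero {p q : Λ.Path} (h : q.r ≠ p.s) : T.t p * T.t q = 0 := by
  rw [← T.mul_vertex p, ← T.vertex_mul q, mul_assoc, ← mul_assoc (T.t (Λ.vertex p.s)),
    T.vertex_orthogonal _ _ h.symm, zero_mul, mul_zero]

theorem star_mul_eq_zero_of_range_ne {p q : Λ.Path} (h : p.r ≠ q.r) :
    star (T.t p) * T.t q = 0 := by
  rw [← T.vertex_mul p, ← T.vertex_mul q, star_mul, T.star_vertex, mul_assoc,
    ← mul_assoc (T.t (Λ.vertex p.r)), T.vertex_orthogonal _ _ h, zero_mul, mul_zero]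

theorem mul_star_eq_zero {p q : Λ.Path} (h : p.s ≠ q.s) : T.t p * star (T.t q) = 0 := by
  rw [← T.mul_vertex p, ← T.mul_vertex q, star_mul, T.star_vertex, mul_assoc,
    ← mul_assoc (T.t (Λ.vertex p.s)), T.vertex_orthogonal _ _ h, zero_mul, mul_zero]

/-- Orthogonality of ranges is forced by the Cuntz-Krieger sum. Expanding the vertex projection in
`s_p^* s_{r(p)} s_p = s_p^* s_p`, the term of `p` already gives the whole right side; the other
terms are positive with sum zero, so each vanishes. -/
theorem star_mul_eq_zero {p q : Λ.Path} (hd : Λ.degree p = Λ.degree q) (h : p ≠ q) :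
    star (T.t p) * T.t q = 0 := by
  classical
  by_cases hr : p.r = q.r
  swap
  · exact T.star_mul_eq_zero_of_range_ne hr
  let _ := CStarAlgebra.spectralOrder B
  let _ := CStarAlgebra.spectralOrderedRing B
  have hp : p ∈ Λ.into p.r (Λ.degree p) := (Λ.mem_into _ _ _).2 ⟨rfl, rfl⟩
  have hq : q ∈ (Λ.into p.r (Λ.degree p)).erase p :=
    Finset.mem_erase.2 ⟨h.symm, (Λ.mem_into _ _ _).2 ⟨hr.symm, hd.symm⟩⟩
  have hsum : ∑ e ∈ (Λ.into p.r (Λ.degree p)).erase p,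
      star (star (T.t e) * T.t p) * (star (T.t e) * T.t p) = 0 := by
    have h1 : star (T.t p) * T.t (Λ.vertex p.r) * T.t p = star (T.t p) * T.t p := by
      rw [mul_assoc, T.vertex_mul]
    rw [T.sum_range _ (Λ.degree p), Finset.mul_sum, Finset.sum_mul,
      ← Finset.add_sum_erase _ _ hp, mul_assoc, T.partialIsometry, add_eq_left] at h1
    rw [← h1]
    exact Finset.sum_congr rfl fun e _ => by simp only [star_mul, star_star, mul_assoc]
  have h0 := (Finset.sum_eq_zero_iff_of_nonneg fun e _ => star_mul_self_nonneg _).1 hsum q hq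
  have := CStarRing.star_mul_self_eq_zero_iff _ |>.1 h0
  rw [← star_star (star (T.t p) * T.t q), star_mul, star_star, this, star_zero]

/-- Used to lengthen the second index of a monomial until its degree dominates that of a given path.
-/
theorem mul_star_eq_sum (p q : Λ.Path) (h : p.s = q.s) (n : Fin k → ℕ) :
    T.t p * star (T.t q) =
      ∑ e ∈ Λ.into p.s n, T.t (p.append e) * star (T.t (q.append e)) := by
  rw [← T.mul_vertex p, T.sum_range _ n, Finset.mul_sum, Finset.sum_mul]
  refine Finset.sum_congr rfl fun e he => ?_
  have he := ((Λ.mem_into _ _ _).1 he).1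
  rw [← T.mul_append he, ← T.mul_append (he.trans h), star_mul, ← mul_assoc, ← mul_assoc]

theorem star_append_mul {p q e : Λ.Path} (h : e.r = p.s) (hd : Λ.degree p = Λ.degree q)
    [Decidable (p = q)] :
    star (T.t (p.append e)) * T.t q = if p = q then star (T.t e) else 0 := by
  rw [← T.mul_append h, star_mul, mul_assoc]
  split_ifs with hpq
  · subst hpq
    rw [T.star_mul_self, ← h, ← T.star_vertex, ← star_mul, T.vertex_mul]
  · rw [T.star_mul_eq_zero hd hpq, mul_zero]

end CKFamily

/-! ### Density of the spanning monomials -/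

variable (Λ : KGraph k V) [Λ.IsFinite]

/-- The linear span of the elements `s_p s_q^*` of `C*(Λ)`. -/
noncomputable def monomialSpan : Submodule ℂ Λ.CStar :=
  Submodule.span ℂ (Set.range fun x : Λ.Path × Λ.Path => Λ.gen x.1 * star (Λ.gen x.2))

variable {Λ}

theorem monomial_mem (p q : Λ.Path) : Λ.gen p * star (Λ.gen q) ∈ Λ.monomialSpan :=
  Submodule.subset_span ⟨(p, q), rfl⟩

theorem gen_mem_monomialSpan (p : Λ.Path) : Λ.gen p ∈ Λ.monomialSpan := by
  have h : Λ.gen p * star (Λ.gen (Λ.vertex p.s)) = Λ.gen p := by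
    have h := Λ.genFamily.mul_vertex p
    rwa [← Λ.genFamily.star_vertex] at h
  rw [← h]
  exact monomial_mem _ _

theorem star_mem_monomialSpan {a : Λ.CStar} (ha : a ∈ Λ.monomialSpan) :
    star a ∈ Λ.monomialSpan := by
  induction ha using Submodule.span_induction with
  | mem x hx =>
    obtain ⟨⟨p, q⟩, rfl⟩ := hx
    simp only [star_mul, star_star]
    exact monomial_mem q p
  | zero => simp
  | add x y _ _ hx hy => rw [star_add]; exact add_mem hx hy
  | smul c x _ hx => rw [star_smul]; exact Submodule.smul_mem _ _ hx

/-- After lengthening `q` by paths of degree `d(e)`, each second index has an initial segment of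
degree `d(e)`. That segment either equals `e` and cancels, or has range orthogonal to that of `e`.
-/
theorem mul_gen_mem_monomialSpan {a : Λ.CStar} (ha : a ∈ Λ.monomialSpan) (e : Λ.Path) :
    a * Λ.gen e ∈ Λ.monomialSpan := by
  classical
  induction ha using Submodule.span_induction with
  | mem x hx =>
    obtain ⟨⟨p, q⟩, rfl⟩ := hx
    change Λ.genFamily.t p * star (Λ.genFamily.t q) * Λ.genFamily.t e ∈ _
    by_cases h : p.s = q.s
    swap
    · rw [CKFamily.mul_star_eq_zero _ h, zero_mul]
      exact zero_mem _
    rw [Λ.genFamily.mul_star_eq_sum p q h (Λ.degree e), Finset.sum_mul]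
    refine sum_mem fun f hf => ?_
    have hf := ((Λ.mem_into _ _ _).1 hf)
    have hqf := hf.1.trans h
    obtain ⟨a, b, hab, heq, ha, -⟩ := Path.exists_eq_append_of_le (p := q.append f)
      (m := Λ.degree e) (by rw [Path.degree_append hqf, hf.2]; exact le_add_self)
    rw [← heq, mul_assoc, CKFamily.star_append_mul _ hab ha]
    split_ifs
    · exact monomial_mem _ _
    · rw [mul_zero]
      exact zero_mem _
  | zero => simp
  | add x y _ _ hx hy => rw [add_mul]; exact add_mem hx hy
  | smul c x _ hx => rw [smul_mul_assoc]; exact Submodule.smul_mem _ _ hx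

theorem mul_star_gen_mem_monomialSpan {a : Λ.CStar} (ha : a ∈ Λ.monomialSpan) (e : Λ.Path) :
    a * star (Λ.gen e) ∈ Λ.monomialSpan := by
  induction ha using Submodule.span_induction with
  | mem x hx =>
    obtain ⟨⟨p, q⟩, rfl⟩ := hx
    change Λ.gen p * star (Λ.gen q) * star (Λ.gen e) ∈ _
    rw [mul_assoc, ← star_mul]
    by_cases h : q.r = e.s
    · rw [show Λ.gen e * Λ.gen q = Λ.gen (e.append q) from Λ.genFamily.mul_append h]
      exact monomial_mem _ _
    · rw [show Λ.gen e * Λ.gen q = 0 from Λ.genFamily.mul_eq_zero h, star_zero, mul_zero]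
      exact zero_mem _
  | zero => simp
  | add x y _ _ hx hy => rw [add_mul]; exact add_mem hx hy
  | smul c x _ hx => rw [smul_mul_assoc]; exact Submodule.smul_mem _ _ hx

theorem mul_mem_monomialSpan {a b : Λ.CStar} (ha : a ∈ Λ.monomialSpan)
    (hb : b ∈ Λ.monomialSpan) : a * b ∈ Λ.monomialSpan := by
  induction hb using Submodule.span_induction with
  | mem x hx =>
    obtain ⟨⟨p, q⟩, rfl⟩ := hx
    change a * (Λ.gen p * star (Λ.gen q)) ∈ _
    rw [← mul_assoc]
    exact mul_star_gen_mem_monomialSpan (mul_gen_mem_monomialSpan ha p) q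
  | zero => simp
  | add x y _ _ hx hy => rw [mul_add]; exact add_mem hx hy
  | smul c x _ hx => rw [mul_smul_comm]; exact Submodule.smul_mem _ _ hx

variable (Λ) in
/-- The span of the elements `s_p s_q^*` as a *-subalgebra of the product of all families. -/
noncomputable def monomialSubalgebra : NonUnitalStarSubalgebra ℂ (BigProd Λ) where
  carrier := (↑) '' (Λ.monomialSpan : Set Λ.CStar)
  add_mem' := by
    rintro _ _ ⟨a, ha, rfl⟩ ⟨b, hb, rfl⟩
    exact ⟨a + b, add_mem ha hb, rfl⟩
  zero_mem' := ⟨0, zero_mem _, rfl⟩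
  mul_mem' := by
    rintro _ _ ⟨a, ha, rfl⟩ ⟨b, hb, rfl⟩
    exact ⟨a * b, mul_mem_monomialSpan ha hb, rfl⟩
  smul_mem' := by
    rintro c _ ⟨a, ha, rfl⟩
    exact ⟨c • a, Submodule.smul_mem _ _ ha, rfl⟩
  star_mem' := by
    rintro _ ⟨a, ha, rfl⟩
    exact ⟨star a, star_mem_monomialSpan ha, rfl⟩

-- The span is a *-subalgebra containing the generators, so its closure is everything.
variable (Λ) in
theorem dense_monomialSpan : Dense (Λ.monomialSpan : Set Λ.CStar) := fun a => by
  rw [closure_subtype]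
  have h : NonUnitalStarAlgebra.adjoin ℂ (Set.range Λ.bigGen) ≤ Λ.monomialSubalgebra := by
    refine NonUnitalStarAlgebra.adjoin_le ?_
    rintro _ ⟨p, rfl⟩
    exact ⟨Λ.gen p, gen_mem_monomialSpan p, rfl⟩
  exact closure_mono h a.2

/-- Continuous linear maps on `C*(Λ)` which agree on the elements `s_p s_q^*` are equal. -/
theorem CStar.clm_ext {E : Type*} [AddCommMonoid E] [Module ℂ E] [TopologicalSpace E] [T2Space E]
    {φ ψ : Λ.CStar →L[ℂ] E}
    (h : ∀ p q, φ (Λ.gen p * star (Λ.gen q)) = ψ (Λ.gen p * star (Λ.gen q))) : φ = ψ := by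
  refine ContinuousLinearMap.ext_on Λ.dense_monomialSpan (s := Set.range _) ?_
  rintro _ ⟨⟨p, q⟩, rfl⟩
  exact h p q

end KGraph

/-! ### Pulling back square-summable functions along partial injections -/

section PartialPullback

variable {Z : Type*}

/-- By injectivity of `g`, distinct nonzero terms are distinct coordinates of `f`, so the sum is at
most a partial sum of the norm of `f`. -/
theorem sum_option_elim_le (g : Z → Option Z) (hg : ∀ a b c, c ∈ g a → c ∈ g b → a = b)
    (f : lp (fun _ : Z => ℂ) 2) (s : Finset Z) :
    ∑ z ∈ s, ‖(g z).elim 0 f‖ ^ (2 : ℝ≥0∞).toReal ≤ ‖f‖ ^ (2 : ℝ≥0∞).toReal := by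
  classical
  refine le_trans (le_of_eq ?_) (lp.sum_rpow_le_norm_rpow (by norm_num) f (s.filterMap g hg))
  refine Finset.sum_bij_ne_zero (fun z _ h => (g z).get ?_) ?_ ?_ ?_ ?_
  · by_contra hz
    simp_all
  · intro a ha h
    simp only [Finset.mem_filterMap]
    exact ⟨a, ha, by simp⟩
  · intro a ha h b hb h' hab
    exact hg a b _ (Option.get_mem _) (Option.mem_def.2 (by rw [hab, Option.some_get]))
  · intro w hw h
    obtain ⟨z, hz, hzw⟩ := (Finset.mem_filterMap g).1 hw
    exact ⟨z, hz, by simpa [hzw] using h, by simp [hzw]⟩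
  · intro a ha h
    obtain ⟨w, hw⟩ : ∃ w, g a = some w := by
      cases hga : g a
      · simp [hga] at h
      · exact ⟨_, rfl⟩
    simp [hw]

/-- The contraction `f ↦ f ∘ g` of `ℓ²(Z)` given by a partial injection `g` of `Z`. -/
noncomputable def partialPullback (g : Z → Option Z)
    (hg : ∀ a b c, c ∈ g a → c ∈ g b → a = b) :
    lp (fun _ : Z => ℂ) 2 →L[ℂ] lp (fun _ : Z => ℂ) 2 :=
  LinearMap.mkContinuous
    { toFun f := ⟨fun z => (g z).elim 0 f, memℓp_gen' (sum_option_elim_le g hg f)⟩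
      map_add' f f' := by
        ext z
        change (g z).elim 0 _ = (g z).elim 0 f + (g z).elim 0 f'
        cases g z
        · exact (add_zero _).symm
        · rfl
      map_smul' c f := by
        ext z
        change (g z).elim 0 _ = c * (g z).elim 0 f
        cases g z
        · exact (mul_zero _).symm
        · rfl } 1 fun f => by
    rw [one_mul]
    exact lp.norm_le_of_forall_sum_le (by norm_num) (norm_nonneg f) (sum_option_elim_le g hg f)

variable {g : Z → Option Z} {hg : ∀ a b c, c ∈ g a → c ∈ g b → a = b}

theorem partialPullback_apply (f : lp (fun _ : Z => ℂ) 2) (z : Z) :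
    partialPullback g hg f z = (g z).elim 0 f := rfl

theorem star_partialPullback_apply [DecidableEq Z] (f : lp (fun _ : Z => ℂ) 2) (w : Z) :
    (star (partialPullback g hg) f : lp (fun _ : Z => ℂ) 2) w =
      inner ℂ (partialPullback g hg (lp.single 2 w (1 : ℂ))) f := by
  rw [← ContinuousLinearMap.adjoint_inner_right, ← ContinuousLinearMap.star_eq_adjoint,
    lp.inner_single_left]
  simp

/-- Since `z` is the only preimage of `w`, the basis vector at `w` pulls back to the one at `z`. The
adjoint is thus push-forward along `g`, with value zero off the range of `g`. -/
theorem star_partialPullback_apply_of_mem {f : lp (fun _ : Z => ℂ) 2} {z w : Z} (h : g z = some w) :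
    (star (partialPullback g hg) f : lp (fun _ : Z => ℂ) 2) w = f z := by
  classical
  have : partialPullback g hg (lp.single 2 w (1 : ℂ)) = lp.single 2 z (1 : ℂ) := by
    ext x
    rw [partialPullback_apply]
    by_cases hx : x = z
    · simp [hx, h]
    · cases hgx : g x with
      | none => simp [hx]
      | some y =>
        have : y ≠ w := fun hy => hx (hg x z w (by rw [hgx, hy]; rfl) h)
        simp [hx, this]
  rw [star_partialPullback_apply, this, lp.inner_single_left]
  simp

theorem star_partialPullback_apply_of_not_mem {f : lp (fun _ : Z => ℂ) 2} {w : Z}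
    (h : ∀ z, g z ≠ some w) :
    (star (partialPullback g hg) f : lp (fun _ : Z => ℂ) 2) w = 0 := by
  classical
  have : partialPullback g hg (lp.single 2 w (1 : ℂ)) = 0 := by
    ext x
    rw [partialPullback_apply]
    cases hgx : g x with
    | none => simp
    | some y =>
      have : y ≠ w := fun hy => h x (by rw [hgx, hy])
      simp [this]
  rw [star_partialPullback_apply, this, inner_zero_left]

end PartialPullback

namespace KGraph

variable {k : ℕ} {V : Type u} [SmallCategory V]

/-! ### A space of infinite paths -/

/-- Ideal infinite paths with a range: germs along an ultrafilter of sequences of paths whose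
degrees tend to infinity. -/
@[ext]
structure InfPath (Λ : KGraph k V) : Type u where
  germ : Filter.Germ (Filter.hyperfilter ℕ : Filter ℕ) Λ.Path
  r : V
  germ_r : germ.LiftPred fun p => p.r = r
  le_degree : ∀ n, germ.LiftPred fun p => n ≤ Λ.degree p

namespace InfPath

variable {Λ : KGraph k V}

open scoped Classical in
/-- The infinite path `py`, with the junk value `y` when the source of `p` is not the range of
`y`. -/
noncomputable def cons (p : Λ.Path) (y : Λ.InfPath) : Λ.InfPath :=
  if h : y.r = p.s then
    { germ := y.germ.map p.append
      r := p.r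
      germ_r := by
        have hy := h ▸ y.germ_r
        generalize y.germ = g at *
        induction g using Filter.Germ.inductionOn with | h f => ?_
        exact Filter.Eventually.mono hy fun j hj => Path.append_r hj
      le_degree n := by
        have hy := h ▸ y.germ_r
        have hd := y.le_degree n
        generalize y.germ = g at *
        induction g using Filter.Germ.inductionOn with | h f => ?_
        simp only [Filter.Germ.map_coe, Filter.Germ.liftPred_coe] at hy hd ⊢
        filter_upwards [hy, hd] with j hj hj'
        rw [Function.comp_apply, Path.degree_append hj]
        exact le_add_left hj' }
  else y

theorem cons_r {p : Λ.Path} {y : Λ.InfPath} (h : y.r = p.s) : (cons p y).r = p.r := by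
  simp [cons, h]

theorem cons_germ {p : Λ.Path} {y : Λ.InfPath} (h : y.r = p.s) :
    (cons p y).germ = y.germ.map p.append := by
  simp [cons, h]

theorem cons_vertex {y : Λ.InfPath} {v : V} (h : y.r = v) : cons (Λ.vertex v) y = y := by
  refine InfPath.ext ?_ ((cons_r h).trans h.symm)
  rw [cons_germ h]
  have hy := h ▸ y.germ_r
  generalize y.germ = g at *
  induction g using Filter.Germ.inductionOn with | h f => ?_
  exact Filter.Germ.coe_eq.2 (hy.mono fun j hj => Path.vertex_append hj)

theorem cons_append {p q : Λ.Path} {y : Λ.InfPath} (h : q.r = p.s) (h' : y.r = q.s) :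
    cons (p.append q) y = cons p (cons q y) := by
  have h1 : (cons q y).r = p.s := (cons_r h').trans h
  have h2 : y.r = (p.append q).s := h'.trans (Path.append_s h).symm
  refine InfPath.ext ?_ ?_
  · rw [cons_germ h1, cons_germ h2, cons_germ h']
    have hy := h' ▸ y.germ_r
    generalize y.germ = g at *
    induction g using Filter.Germ.inductionOn with | h f => ?_
    exact Filter.Germ.coe_eq.2 (hy.mono fun j hj => Path.append_assoc h hj)
  · rw [cons_r h1, cons_r h2, Path.append_r h]

theorem germ_append_inj {p q : Λ.Path}
    {y z : Filter.Germ (Filter.hyperfilter ℕ : Filter ℕ) Λ.Path}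
    (hy : y.LiftPred fun e => e.r = p.s) (hz : z.LiftPred fun e => e.r = q.s)
    (hd : Λ.degree p = Λ.degree q) (he : y.map p.append = z.map q.append) : p = q ∧ y = z := by
  induction y using Filter.Germ.inductionOn with | h f => ?_
  induction z using Filter.Germ.inductionOn with | h g => ?_
  simp only [Filter.Germ.map_coe, Filter.Germ.coe_eq, Filter.Germ.liftPred_coe] at he hy hz ⊢
  have : ∀ᶠ j in (Filter.hyperfilter ℕ : Filter ℕ), p = q ∧ f j = g j := by
    filter_upwards [he, hy, hz] with j h1 h2 h3
    exact Path.append_inj h2 h3 hd h1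
  -- The equality `p = q` does not involve `j`, so a single index suffices for it.
  exact ⟨this.exists.choose_spec.1, this.mono fun _ h => h.2⟩

theorem cons_inj {p q : Λ.Path} {y z : Λ.InfPath} (h : y.r = p.s) (h' : z.r = q.s)
    (hd : Λ.degree p = Λ.degree q) (he : cons p y = cons q z) : p = q ∧ y = z := by
  have he' := congrArg (fun y => y.germ) he
  simp only [cons_germ h, cons_germ h'] at he'
  have key := germ_append_inj (h ▸ y.germ_r) (h' ▸ z.germ_r) hd he'
  obtain ⟨rfl, h2⟩ := key
  exact ⟨rfl, InfPath.ext h2 (h.trans h'.symm)⟩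

/-- Almost every term of the sequence has an initial segment in the finite set `vΛ^n`. The
ultrafilter selects one `p` that occurs for almost all indices, and the remaining tails represent
`z`. -/
theorem exists_cons [Λ.IsFinite] (y : Λ.InfPath) (n : Fin k → ℕ) :
    ∃ p z, z.r = p.s ∧ cons p z = y ∧ Λ.degree p = n := by
  classical
  obtain ⟨y, v, hy, hd⟩ := y
  induction y using Filter.Germ.inductionOn with | h f => ?_
  simp only [Filter.Germ.liftPred_coe] at hy hd
  have h1 : ∀ᶠ j in (Filter.hyperfilter ℕ : Filter ℕ), ∃ p ∈ {p : Λ.Path | p.r = v ∧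
      Λ.degree p = n}, ∃ q : Λ.Path, q.r = p.s ∧ p.append q = f j := by
    filter_upwards [hy, hd n] with j hj hj'
    obtain ⟨a, b, hab, he, ha, -⟩ := Path.exists_eq_append_of_le hj'
    refine ⟨a, ⟨?_, ha⟩, b, hab, he⟩
    rw [← Path.append_r hab, he, hj]
  obtain ⟨p, ⟨hpr, hpn⟩, hp⟩ :=
    (Ultrafilter.eventually_exists_mem_iff (Λ.finite_into v n)).1 h1
  let g : ℕ → Λ.Path := fun j => if h : ∃ q : Λ.Path, q.r = p.s ∧ p.append q = f j then
    h.choose else p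
  have hg : ∀ᶠ j in (Filter.hyperfilter ℕ : Filter ℕ), (g j).r = p.s ∧ p.append (g j) = f j := by
    filter_upwards [hp] with j hj
    have : g j = hj.choose := dif_pos hj
    rw [this]
    exact hj.choose_spec
  let z : Λ.InfPath := ⟨(g : Filter.Germ (Filter.hyperfilter ℕ : Filter ℕ) Λ.Path), p.s,
    hg.mono fun j hj => hj.1, fun m => by
      simp only [Filter.Germ.liftPred_coe]
      filter_upwards [hg, hd (n + m)] with j hj hj'
      rw [← hj.2, Path.degree_append hj.1, hpn] at hj'
      exact le_of_add_le_add_left hj'⟩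
  refine ⟨p, z, rfl, InfPath.ext ?_ ?_, hpn⟩
  · rw [cons_germ rfl]
    exact Filter.Germ.coe_eq.2 (hg.mono fun j hj => hj.2)
  · rw [cons_r rfl, hpr]

theorem exists_r_eq (hΛ : Λ.NoSources) (v : V) : ∃ y : Λ.InfPath, y.r = v := by
  choose f hf using fun j : ℕ => hΛ v fun _ => j
  refine ⟨⟨(f : Filter.Germ (Filter.hyperfilter ℕ : Filter ℕ) Λ.Path), v,
    Filter.Eventually.of_forall fun j => (hf j).1, fun n => ?_⟩, rfl⟩
  simp only [Filter.Germ.liftPred_coe]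
  refine Filter.hyperfilter_le_cofinite ?_
  rw [Nat.cofinite_eq_atTop]
  -- The sum of the coordinates of `n` is a threshold dominating each of them.
  refine (Filter.eventually_ge_atTop (∑ i, n i)).mono fun j hj i => ?_
  rw [(hf j).2]
  exact (Finset.single_le_sum (fun _ _ => Nat.zero_le _) (Finset.mem_univ i)).trans hj

end InfPath

/-! ### The graded infinite path representation -/

section Representation

variable (Λ : KGraph k V)

/-- The Hilbert space of the graded infinite path representation. -/
abbrev PathSpace : Type u := lp (fun _ : Λ.InfPath × (Fin k → ℤ) => ℂ) 2

variable {Λ}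

open scoped Classical in
/-- The partial injection `(y, m) ↦ (py, m + d(p))`. -/
noncomputable def gradedCons (p : Λ.Path) (z : Λ.InfPath × (Fin k → ℤ)) :
    Option (Λ.InfPath × (Fin k → ℤ)) :=
  if z.1.r = p.s then some (z.1.cons p, fun i => z.2 i + Λ.degree p i) else none

theorem gradedCons_of_eq {p : Λ.Path} {z : Λ.InfPath × (Fin k → ℤ)} (h : z.1.r = p.s) :
    gradedCons p z = some (z.1.cons p, fun i => z.2 i + Λ.degree p i) := if_pos h

theorem gradedCons_of_ne {p : Λ.Path} {z : Λ.InfPath × (Fin k → ℤ)} (h : z.1.r ≠ p.s) :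
    gradedCons p z = none := if_neg h

theorem gradedCons_eq_some {p : Λ.Path} {z w : Λ.InfPath × (Fin k → ℤ)}
    (h : gradedCons p z = some w) :
    z.1.r = p.s ∧ z.1.cons p = w.1 ∧ ∀ i, z.2 i + Λ.degree p i = w.2 i := by
  by_cases hz : z.1.r = p.s
  · rw [gradedCons_of_eq hz, Option.some.injEq] at h
    rw [← h]
    exact ⟨hz, rfl, fun _ => rfl⟩
  · simp [gradedCons_of_ne hz] at h

theorem gradedCons_inj (p : Λ.Path) (a b c : Λ.InfPath × (Fin k → ℤ)) (ha : c ∈ gradedCons p a)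
    (hb : c ∈ gradedCons p b) : a = b := by
  obtain ⟨h1, h2, h3⟩ := gradedCons_eq_some ha
  obtain ⟨h1', h2', h3'⟩ := gradedCons_eq_some hb
  refine Prod.ext (InfPath.cons_inj h1 h1' rfl (h2.trans h2'.symm)).2 (funext fun i => ?_)
  exact add_right_cancel ((h3 i).trans (h3' i).symm)

/-- The adjoint of the operator of the path `p` in the graded infinite path representation. -/
noncomputable def pathShift (p : Λ.Path) : Λ.PathSpace →L[ℂ] Λ.PathSpace :=
  partialPullback (gradedCons p) (gradedCons_inj p)

theorem pathShift_apply_of_eq {p : Λ.Path} {y : Λ.InfPath} (h : y.r = p.s) (m : Fin k → ℤ)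
    (f : Λ.PathSpace) : pathShift p f (y, m) = f (y.cons p, fun i => m i + Λ.degree p i) := by
  rw [pathShift, partialPullback_apply, gradedCons_of_eq h, Option.elim_some]

theorem pathShift_apply_of_ne {p : Λ.Path} {y : Λ.InfPath} (h : y.r ≠ p.s) (m : Fin k → ℤ)
    (f : Λ.PathSpace) : pathShift p f (y, m) = 0 := by
  rw [pathShift, partialPullback_apply, gradedCons_of_ne h, Option.elim_none]

theorem star_pathShift_apply_cons {p : Λ.Path} {y : Λ.InfPath} (h : y.r = p.s) (m : Fin k → ℤ)
    (f : Λ.PathSpace) :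
    (star (pathShift p) f : Λ.PathSpace) (y.cons p, fun i => m i + Λ.degree p i) = f (y, m) :=
  star_partialPullback_apply_of_mem (gradedCons_of_eq h)

theorem star_pathShift_apply_of_ne {p : Λ.Path} {y : Λ.InfPath}
    (h : ∀ z : Λ.InfPath, z.r = p.s → z.cons p ≠ y) (m : Fin k → ℤ) (f : Λ.PathSpace) :
    (star (pathShift p) f : Λ.PathSpace) (y, m) = 0 :=
  star_partialPullback_apply_of_not_mem fun z hz =>
    h z.1 (gradedCons_eq_some hz).1 (gradedCons_eq_some hz).2.1

theorem star_pathShift_pathShift_apply_of_eq {p : Λ.Path} {y z : Λ.InfPath} (h : z.r = p.s)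
    (hy : z.cons p = y) (m : Fin k → ℤ) (f : Λ.PathSpace) :
    (star (pathShift p) (pathShift p f) : Λ.PathSpace) (y, m) = f (y, m) := by
  obtain rfl := hy
  -- The subtraction is possible because the grading takes values in `ℤ^k`.
  have hm : m = fun i => (m i - Λ.degree p i) + Λ.degree p i := by simp
  rw [hm, star_pathShift_apply_cons h (fun i => m i - Λ.degree p i), pathShift_apply_of_eq h]

theorem pathShift_vertex_apply_of_eq {y : Λ.InfPath} {v : V} (h : y.r = v) (m : Fin k → ℤ)
    (f : Λ.PathSpace) : pathShift (Λ.vertex v) f (y, m) = f (y, m) := by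
  rw [pathShift_apply_of_eq h, InfPath.cons_vertex h]
  simp [Path.degree_vertex]

theorem star_pathShift_vertex (v : V) :
    star (pathShift (Λ.vertex v)) = pathShift (Λ.vertex v) := by
  ext f ⟨y, m⟩
  by_cases h : y.r = v
  · rw [pathShift_vertex_apply_of_eq h]
    have := star_pathShift_apply_cons (p := Λ.vertex v) h m f
    rw [InfPath.cons_vertex h] at this
    simpa [Path.degree_vertex] using this
  · rw [pathShift_apply_of_ne h, star_pathShift_apply_of_ne]
    rintro z hz rfl
    exact h ((InfPath.cons_r hz).trans rfl)

theorem pathShift_mul_star_self (p : Λ.Path) :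
    pathShift p * star (pathShift p) = pathShift (Λ.vertex p.s) := by
  ext f ⟨y, m⟩
  rw [mul_apply_eq_comp]
  by_cases h : y.r = p.s
  · rw [pathShift_apply_of_eq h, star_pathShift_apply_cons h, pathShift_vertex_apply_of_eq h]
  · rw [pathShift_apply_of_ne h]
    exact (pathShift_apply_of_ne (p := Λ.vertex p.s) h _ _).symm

theorem pathShift_mul {p q : Λ.Path} (h : q.r = p.s) :
    pathShift q * pathShift p = pathShift (p.append q) := by
  ext f ⟨y, m⟩
  rw [mul_apply_eq_comp]
  by_cases h' : y.r = q.s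
  · rw [pathShift_apply_of_eq h', pathShift_apply_of_eq ((InfPath.cons_r h').trans h),
      pathShift_apply_of_eq (h'.trans (Path.append_s h).symm), InfPath.cons_append h h',
      Path.degree_append h]
    have : (fun i => m i + ((Λ.degree p + Λ.degree q) i : ℕ)) =
        fun i => m i + (Λ.degree q i : ℤ) + (Λ.degree p i : ℤ) := by
      funext i
      rw [Pi.add_apply, Nat.cast_add]
      ring
    rw [this]
  · rw [pathShift_apply_of_ne h', pathShift_apply_of_ne]
    rwa [Path.append_s h]

/-- An infinite path has exactly one initial segment of degree `n`, so at each basis point at most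
one summand survives. -/
theorem pathShift_vertex_eq_sum [Λ.IsFinite] (v : V) (n : Fin k → ℕ) :
    pathShift (Λ.vertex v) = ∑ p ∈ Λ.into v n, star (pathShift p) * pathShift p := by
  classical
  ext f ⟨y, m⟩
  have hsum : ((∑ p ∈ Λ.into v n, star (pathShift p) * pathShift p) f : Λ.PathSpace) (y, m) =
      ∑ p ∈ Λ.into v n, (star (pathShift p) (pathShift p f) : Λ.PathSpace) (y, m) := by
    rw [sum_apply, lp.coeFn_sum, Finset.sum_apply]
    rfl
  rw [hsum]
  obtain ⟨p, z, hz, hzy, hp⟩ := y.exists_cons n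
  have hr : y.r = p.r := by rw [← hzy, InfPath.cons_r hz]
  have hne : ∀ q : Λ.Path, Λ.degree q = n → q ≠ p →
      (star (pathShift q) (pathShift q f) : Λ.PathSpace) (y, m) = 0 := by
    intro q hq hqp
    refine star_pathShift_apply_of_ne (fun z' hz' h => hqp ?_) _ _
    exact (InfPath.cons_inj hz' hz (hq.trans hp.symm) (h.trans hzy.symm)).1
  by_cases h : y.r = v
  · rw [pathShift_vertex_apply_of_eq h, Finset.sum_eq_single p,
      star_pathShift_pathShift_apply_of_eq hz hzy]
    · exact fun q hq hqp => hne q ((Λ.mem_into _ _ _).1 hq).2 hqp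
    · exact fun hp' => absurd ((Λ.mem_into _ _ _).2 ⟨hr.symm.trans h, hp⟩) hp'
  · rw [pathShift_apply_of_ne h, Finset.sum_eq_zero]
    intro q hq
    rw [Λ.mem_into] at hq
    refine hne q hq.2 ?_
    rintro rfl
    exact h (hr.trans hq.1)

variable (Λ) in
/-- The graded infinite path representation. -/
noncomputable def pathFamily [Λ.IsFinite] : CKFamily Λ (Λ.PathSpace →L[ℂ] Λ.PathSpace) where
  t p := star (pathShift p)
  partialIsometry p := by
    rw [star_star, mul_assoc, pathShift_mul_star_self, ← star_pathShift_vertex, ← star_mul,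
      pathShift_mul rfl, Path.append_vertex rfl]
  vertex_proj v := by
    rw [star_pathShift_vertex]
    refine ⟨?_, star_pathShift_vertex v⟩
    exact (pathShift_mul rfl).trans (by rw [Path.append_vertex (v := v) rfl])
  vertex_orthogonal v w h := by
    rw [star_pathShift_vertex, star_pathShift_vertex]
    ext f ⟨y, m⟩
    rw [mul_apply_eq_comp]
    by_cases hv : y.r = v
    · rw [pathShift_vertex_apply_of_eq hv, pathShift_apply_of_ne (by subst hv; exact h)]
      rfl
    · rw [pathShift_apply_of_ne hv]
      rfl
  mul μ ν := by
    rw [← star_mul, pathShift_mul rfl, Path.append_mk]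
  star_mul_self p := by
    rw [star_star, pathShift_mul_star_self, star_pathShift_vertex]
  sum_range v n := by
    rw [star_pathShift_vertex, pathShift_vertex_eq_sum v n]
    simp only [star_star]

-- This is where the grading matters. If `y = pz`, the value is the coordinate of the basis vector
-- at `(qz, d(q) - d(p))`. It vanishes unless `d(p) = d(q)` and `qz = y = pz`, and then `p = q` by
-- unique factorization.
open scoped Classical in
theorem star_pathShift_pathShift_single (p q : Λ.Path) (y : Λ.InfPath) :
    (star (pathShift p) (pathShift q (lp.single 2 (y, 0) (1 : ℂ))) : Λ.PathSpace) (y, 0) =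
      if p = q ∧ ∃ z : Λ.InfPath, z.r = p.s ∧ z.cons p = y then 1 else 0 := by
  by_cases hp : ∃ z : Λ.InfPath, z.r = p.s ∧ z.cons p = y
  swap
  · rw [if_neg fun h => hp h.2, star_pathShift_apply_of_ne]
    exact fun z hz h => hp ⟨z, hz, h⟩
  by_cases hpq : p = q
  · subst hpq
    obtain ⟨z, hz, hzy⟩ := hp
    rw [star_pathShift_pathShift_apply_of_eq hz hzy, if_pos ⟨rfl, z, hz, hzy⟩]
    simp
  rw [if_neg fun h => hpq h.1]
  obtain ⟨z, hz, hzy⟩ := hp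
  have h1 := star_pathShift_apply_cons (p := p) hz (fun i => -(Λ.degree p i : ℤ))
    (pathShift q (lp.single 2 (y, 0) (1 : ℂ)))
  simp only [neg_add_cancel, hzy] at h1
  refine Eq.trans h1 ?_
  by_cases hq : z.r = q.s
  swap
  · exact pathShift_apply_of_ne hq _ _
  rw [pathShift_apply_of_eq hq, lp.single_apply_ne]
  intro h
  obtain ⟨h2, h3⟩ := Prod.mk.inj h
  refine hpq (InfPath.cons_inj hz hq (funext fun i => ?_) (hzy.trans h2.symm)).1
  have := congrFun h3 i
  simp only [Pi.zero_apply] at this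
  omega

end Representation

end KGraph

namespace KGraph

variable {k : ℕ} {V : Type u} [SmallCategory V]

/-! ### Bounded functionals from weights on paths -/

section Weights

variable {Λ : KGraph k V}

open scoped Classical in
/-- The basis vector of the infinite path `y` in degree zero. -/
noncomputable def InfPath.basisVec (y : Λ.InfPath) : Λ.PathSpace := lp.single 2 (y, 0) (1 : ℂ)

theorem InfPath.norm_basisVec (y : Λ.InfPath) : ‖y.basisVec‖ = 1 := by
  classical
  rw [basisVec, lp.norm_single (by norm_num), norm_one]

/-- Whether `py` begins with `q` is decided by `p` alone, by uniqueness of initial segments of a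
given degree. Hence the tails chosen later are immaterial. -/
theorem InfPath.exists_cons_eq_cons_iff {p q : Λ.Path} {y : Λ.InfPath} (hy : y.r = p.s)
    (h : Λ.degree q ≤ Λ.degree p) :
    (∃ z : Λ.InfPath, z.r = q.s ∧ z.cons q = y.cons p) ↔
      ∃ e : Λ.Path, e.r = q.s ∧ q.append e = p := by
  constructor
  · rintro ⟨z, hz, hzy⟩
    obtain ⟨a, b, hab, rfl, hd, -⟩ := Path.exists_eq_append_of_le h
    rw [Path.append_s hab] at hy
    rw [InfPath.cons_append hab hy] at hzy
    obtain ⟨rfl, -⟩ := InfPath.cons_inj hz ((InfPath.cons_r hy).trans hab) hd.symm hzy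
    exact ⟨b, hab, rfl⟩
  · rintro ⟨e, he, rfl⟩
    rw [Path.append_s he] at hy
    exact ⟨y.cons e, (InfPath.cons_r hy).trans he, (InfPath.cons_append he hy).symm⟩

variable (Λ) [Λ.IsFinite]

theorem norm_lift_le (i : CKRep Λ) (a : Λ.CStar) : ‖Λ.lift i a‖ ≤ ‖a‖ :=
  lp.norm_apply_le_norm ENNReal.top_ne_zero (a : BigProd Λ) i

/-- The graded infinite path representation, bundled. -/
noncomputable def pathRep : CKRep Λ := ⟨Λ.PathSpace →L[ℂ] Λ.PathSpace, Λ.pathFamily⟩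

/-- The representation of `C*(Λ)` on the Hilbert space of graded infinite paths. -/
noncomputable def pathHom : Λ.CStar →⋆ₙₐ[ℂ] (Λ.PathSpace →L[ℂ] Λ.PathSpace) := Λ.lift Λ.pathRep

theorem norm_pathHom_le (a : Λ.CStar) : ‖Λ.pathHom a‖ ≤ ‖a‖ := Λ.norm_lift_le Λ.pathRep a

theorem pathHom_gen (p : Λ.Path) : Λ.pathHom (Λ.gen p) = star (pathShift p) := rfl

variable {Λ}

/-- The vector functional of the infinite path `y`. -/
noncomputable def InfPath.functional (y : Λ.InfPath) : Λ.CStar →L[ℂ] ℂ :=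
  LinearMap.mkContinuous
    { toFun a := inner ℂ y.basisVec (Λ.pathHom a y.basisVec)
      map_add' a b := by rw [map_add, add_apply, inner_add_right]
      map_smul' c a := by
        rw [map_smul, smul_apply, inner_smul_right]
        rfl } 1 fun a => by
    refine (norm_inner_le_norm (𝕜 := ℂ) y.basisVec (Λ.pathHom a y.basisVec)).trans ?_
    rw [y.norm_basisVec]
    gcongr
    change ‖Λ.pathHom a y.basisVec‖ ≤ ‖a‖
    refine ((Λ.pathHom a).le_opNorm _).trans ?_
    rw [y.norm_basisVec, mul_one]
    exact Λ.norm_pathHom_le a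

theorem InfPath.functional_apply (y : Λ.InfPath) (a : Λ.CStar) :
    y.functional a = inner ℂ y.basisVec (Λ.pathHom a y.basisVec) := rfl

theorem InfPath.norm_functional_apply_le (y : Λ.InfPath) (a : Λ.CStar) :
    ‖y.functional a‖ ≤ ‖a‖ := by
  simpa only [one_mul] using y.functional.le_of_opNorm_le
    (LinearMap.mkContinuous_norm_le _ zero_le_one _) a

theorem InfPath.functional_star_mul_self (y : Λ.InfPath) (a : Λ.CStar) :
    y.functional (star a * a) = ((‖Λ.pathHom a y.basisVec‖ ^ 2 : ℝ) : ℂ) := by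
  rw [functional_apply, map_mul, map_star, mul_apply_eq_comp, ContinuousLinearMap.star_eq_adjoint,
    ContinuousLinearMap.adjoint_inner_right, inner_self_eq_norm_sq_to_K]
  norm_cast

open scoped Classical in
theorem InfPath.functional_monomial (y : Λ.InfPath) (p q : Λ.Path) :
    y.functional (Λ.gen p * star (Λ.gen q)) =
      if p = q ∧ ∃ z : Λ.InfPath, z.r = p.s ∧ z.cons p = y then 1 else 0 := by
  rw [functional_apply, map_mul, map_star, pathHom_gen, pathHom_gen, star_star,
    mul_apply_eq_comp, basisVec, lp.inner_single_left, star_pathShift_pathShift_single]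
  split_ifs <;> simp

open scoped Classical in
theorem sum_ofDegree_ite (w : Λ.Path → ℝ) (q : Λ.Path) {n : Fin k → ℕ} (h : Λ.degree q ≤ n) :
    ∑ p ∈ Λ.ofDegree n, (if ∃ e : Λ.Path, e.r = q.s ∧ q.append e = p then w p else 0) =
      ∑ e ∈ Λ.into q.s (n - Λ.degree q), w (q.append e) := by
  rw [← Finset.sum_filter]
  symm
  refine Finset.sum_bij (fun e _ => q.append e) ?_ ?_ ?_ ?_
  · intro e he
    obtain ⟨h1, h2⟩ := (Λ.mem_into _ _ _).1 he
    rw [Finset.mem_filter, Λ.mem_ofDegree, Path.degree_append h1, h2]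
    exact ⟨add_tsub_cancel_of_le h, e, h1, rfl⟩
  · intro e he f hf hef
    rw [Λ.mem_into] at he hf
    exact (Path.append_inj he.1 hf.1 rfl hef).2
  · intro p hp
    rw [Finset.mem_filter, Λ.mem_ofDegree] at hp
    obtain ⟨hp, e, he, rfl⟩ := hp
    refine ⟨e, ?_, rfl⟩
    rw [Λ.mem_into, ← hp, Path.degree_append he, add_tsub_cancel_left]
    exact ⟨he, rfl⟩
  · intro e _
    rfl

open scoped Classical in
/-- A consistent family of weights on the paths defines a positive functional on `C*(Λ)`. -/
theorem exists_functional_of_weight (hΛ : Λ.NoSources) (w : Λ.Path → ℝ) (hw0 : ∀ p, 0 ≤ w p)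
    (hw : ∀ p n, w p = ∑ e ∈ Λ.into p.s n, w (p.append e))
    (hw1 : ∀ n, ∑ p ∈ Λ.ofDegree n, w p = 1) :
    ∃ φ : Λ.CStar →L[ℂ] ℂ, ‖φ‖ ≤ 1 ∧
      (∀ a, 0 ≤ (φ (star a * a)).re ∧ (φ (star a * a)).im = 0) ∧
      ∀ p q, φ (Λ.gen p * star (Λ.gen q)) = if p = q then (w p : ℂ) else 0 := by
  choose y hy using fun v => InfPath.exists_r_eq hΛ v
  -- The mass of each `p` of degree `(j,…,j)` is placed on one infinite path beginning with `p`,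
  -- with an arbitrary tail.
  let F : ℕ → Λ.CStar →L[ℂ] ℂ := fun j =>
    ∑ p ∈ Λ.ofDegree (fun _ => j), (w p : ℂ) • ((y p.s).cons p).functional
  have hF : ∀ j a, F j a =
      ∑ p ∈ Λ.ofDegree (fun _ => j), (w p : ℂ) * ((y p.s).cons p).functional a := fun j a => by
    simp only [F, sum_apply, smul_apply, smul_eq_mul]
  have hF1 : ∀ j, ‖F j‖ ≤ 1 := fun j => by
    refine ContinuousLinearMap.opNorm_le_bound _ zero_le_one fun a => ?_
    rw [hF, ← hw1 fun _ => j, Finset.sum_mul]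
    refine norm_sum_le_of_le _ fun p _ => ?_
    rw [norm_mul, Complex.norm_of_nonneg (hw0 p)]
    exact mul_le_mul_of_nonneg_left (((y p.s).cons p).norm_functional_apply_le a) (hw0 p)
  have hFpos : ∀ j a, 0 ≤ (F j (star a * a)).re ∧ (F j (star a * a)).im = 0 := fun j a => by
    simp only [hF, InfPath.functional_star_mul_self]
    norm_cast
    exact ⟨Finset.sum_nonneg fun p _ => mul_nonneg (hw0 p) (sq_nonneg _), rfl⟩
  have hFval : ∀ p q : Λ.Path, ∀ᶠ j in Filter.atTop,
      F j (Λ.gen p * star (Λ.gen q)) = if p = q then (w p : ℂ) else 0 := fun p q => by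
    filter_upwards [Filter.eventually_ge_atTop (∑ i, Λ.degree p i)] with j hj
    have hd : Λ.degree p ≤ fun _ => j := fun i =>
      (Finset.single_le_sum (fun _ _ => Nat.zero_le _) (Finset.mem_univ i)).trans hj
    simp only [hF, InfPath.functional_monomial]
    by_cases hpq : p = q
    -- Consistency of the weights, applied to the extensions of `p` to degree `(j,…,j)`, identifies
    -- `w p` with the mass on infinite paths beginning with `p`.
    · rw [if_pos hpq, hw p ((fun _ => j) - Λ.degree p), ← sum_ofDegree_ite w p hd,
        Complex.ofReal_sum]
      refine Finset.sum_congr rfl fun e he => ?_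
      have he := (Λ.mem_ofDegree _ _).1 he
      rw [InfPath.exists_cons_eq_cons_iff (hy e.s) (by rwa [he])]
      by_cases hc : ∃ f : Λ.Path, f.r = p.s ∧ p.append f = e
      · rw [if_pos hc, if_pos ⟨hpq, hc⟩, mul_one]
      · rw [if_neg hc, if_neg fun h => hc h.2, mul_zero, Complex.ofReal_zero]
    · rw [if_neg hpq]
      refine Finset.sum_eq_zero fun e _ => ?_
      rw [if_neg fun h => hpq h.1, mul_zero]
  -- Banach-Alaoglu supplies a limit on the whole algebra; along a nonprincipal ultrafilter it
  -- retains the eventual values on monomials.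
  let G : ℕ → WeakDual ℂ Λ.CStar := fun j => StrongDual.toWeakDual (F j)
  have hK := WeakDual.isCompact_closedBall (0 : StrongDual ℂ Λ.CStar) 1
  obtain ⟨φ, hφK, hφ⟩ := hK.ultrafilter_le_nhds ((Filter.hyperfilter ℕ).map G) (by
    refine Filter.le_principal_iff.2 (Filter.mem_map.2 (Filter.univ_mem' fun j => ?_))
    simpa [G] using hF1 j)
  have hlim : ∀ a, Filter.Tendsto (fun j => F j a) (Filter.hyperfilter ℕ) (nhds (φ a)) := fun a =>
    ((WeakDual.eval_continuous a).tendsto φ).comp hφ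
  refine ⟨WeakDual.toStrongDual φ, by simpa using hφK, fun a => ⟨?_, ?_⟩, fun p q => ?_⟩
  · exact ge_of_tendsto' ((Complex.continuous_re.tendsto _).comp (hlim (star a * a)))
      fun j => (hFpos j a).1
  · exact tendsto_nhds_unique ((Complex.continuous_im.tendsto _).comp (hlim (star a * a)))
      (tendsto_const_nhds.congr fun j => (hFpos j a).2.symm)
  · refine tendsto_nhds_unique (hlim _) (Filter.Tendsto.congr' ?_ tendsto_const_nhds)
    have := hFval p q
    rw [← Nat.cofinite_eq_atTop] at this
    exact (this.filter_mono Filter.hyperfilter_le_cofinite).mono fun j hj => hj.symm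

end Weights

end KGraph

/-! ### Measures of the ranges in a semibranching system -/

theorem measure_eq_sum_of_ae_partition {X : Type*} [MeasurableSpace X] {μ : Measure X} {ι : Type*}
    (s : Finset ι) {A : ι → Set X} (hA : ∀ i ∈ s, NullMeasurableSet (A i) μ)
    (hcover : μ (⋃ i ∈ s, A i)ᶜ = 0)
    (hdisj : ∀ i ∈ s, ∀ j ∈ s, i ≠ j → μ (A i ∩ A j) = 0) {E : Set X}
    (hE : NullMeasurableSet E μ) : μ E = ∑ i ∈ s, μ (E ∩ A i) := by
  rw [← measure_biUnion_finset₀ (fun i hi j hj hij => ?_) fun i hi => hE.inter (hA i hi),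
    ← Set.inter_iUnion₂]
  · exact (measure_inter_conull hcover).symm
  · exact measure_mono_null (Set.inter_subset_inter Set.inter_subset_right Set.inter_subset_right)
      (hdisj i hi j hj hij)

namespace KGraph.SemibranchingSystem

variable {k : ℕ} {V : Type u} [SmallCategory V] {Λ : KGraph k V}
  {X : Type*} [MeasurableSpace X] {μ : Measure X} (S : Λ.SemibranchingSystem μ)

theorem measurableSet_D (p : Λ.Path) : MeasurableSet (S.D p) :=
  (S.semibranching (Λ.degree p)).measurable_domain ⟨p, rfl⟩

theorem nullMeasurableSet_R (p : Λ.Path) : NullMeasurableSet (S.R p) μ :=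
  (S.semibranching (Λ.degree p)).measurable_range ⟨p, rfl⟩

theorem R_vertex (v : V) : S.R (Λ.vertex v) = S.D (Λ.vertex v) := by
  ext x
  constructor
  · rintro ⟨y, hy, rfl⟩
    rwa [S.vertex_id v y hy]
  · exact fun hx => ⟨x, hx, S.vertex_id v x hx⟩

theorem measure_D (p : Λ.Path) : μ (S.D p) = μ (S.D (Λ.vertex p.s)) := by
  obtain ⟨f⟩ := p
  have := S.domain_comp f (𝟙 _)
  rw [Category.id_comp] at this
  exact measure_congr this

theorem R_subset (p : Λ.Path) : S.R p ≤ᵐ[μ] S.R (Λ.vertex p.r) := by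
  rw [R_vertex]
  obtain ⟨f⟩ := p
  exact S.range_subset (𝟙 _) f

theorem measure_inter_R {p q : Λ.Path} (hd : Λ.degree p = Λ.degree q) (h : p ≠ q) :
    μ (S.R p ∩ S.R q) = 0 :=
  (S.semibranching (Λ.degree q)).disjoint ⟨p, hd⟩ ⟨q, rfl⟩ fun h' => h (Subtype.ext_iff.1 h')

/-- The derivative is integrated over all of `D_p`, which agrees almost everywhere with the domain
of the source vertex, where the prefixing map is the identity. -/
theorem measure_R_of_isRNDerivOn_const {p : Λ.Path} {c : ℝ≥0∞}
    (h : IsRNDerivOn μ (S.D p) (S.τ p) fun _ => c) :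
    μ (S.R p) = c * μ (S.R (Λ.vertex p.s)) := by
  rw [R, h.2 _ (S.measurableSet_D p) subset_rfl, setLIntegral_const, S.measure_D, S.R_vertex]

variable [Λ.IsFinite]

theorem measure_compl_iUnion_R (n : Fin k → ℕ) : μ (⋃ p ∈ Λ.ofDegree n, S.R p)ᶜ = 0 := by
  refine measure_mono_null (Set.compl_subset_compl.2 ?_) (S.semibranching n).cover
  refine Set.iUnion_subset fun p => ?_
  exact Set.subset_biUnion_of_mem (u := S.R) ((Λ.mem_ofDegree n p.1).2 p.2)

theorem measure_eq_sum_inter_R {E : Set X} (hE : NullMeasurableSet E μ) (n : Fin k → ℕ) :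
    μ E = ∑ p ∈ Λ.ofDegree n, μ (E ∩ S.R p) :=
  measure_eq_sum_of_ae_partition _ (fun p _ => S.nullMeasurableSet_R p)
    (S.measure_compl_iUnion_R n) (fun p hp q hq h => S.measure_inter_R
      (((Λ.mem_ofDegree n p).1 hp).trans ((Λ.mem_ofDegree n q).1 hq).symm) h) hE

theorem sum_measure_R (n : Fin k → ℕ) : ∑ p ∈ Λ.ofDegree n, μ (S.R p) = μ Set.univ := by
  rw [S.measure_eq_sum_inter_R nullMeasurableSet_univ n]
  simp only [Set.univ_inter]

/-- The ranges of degree `n` partition `X` almost everywhere. Those of paths into `v` lie in `D_v`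
up to null sets; the others lie in the domain of another vertex, which meets `D_v` in a null set by
the semibranching condition in degree zero. -/
theorem measure_R_vertex_eq_sum (v : V) (n : Fin k → ℕ) :
    μ (S.R (Λ.vertex v)) = ∑ p ∈ Λ.into v n, μ (S.R p) := by
  classical
  rw [S.measure_eq_sum_inter_R (S.nullMeasurableSet_R _) n]
  symm
  refine Finset.sum_subset_zero_on_sdiff (fun p hp => ?_) (fun p hp => ?_) fun p hp => ?_
  · exact (Λ.mem_ofDegree _ _).2 ((Λ.mem_into _ _ _).1 hp).2
  · rw [Finset.mem_sdiff, Λ.mem_ofDegree, Λ.mem_into] at hp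
    have hne : v ≠ p.r := fun h => hp.2 ⟨h.symm, hp.1⟩
    refine measure_mono_null_ae ?_ (S.measure_inter_R (p := Λ.vertex v) (q := Λ.vertex p.r)
      (by simp [Path.degree_vertex]) fun h => hne (Path.vertex_injective h))
    exact (Filter.EventuallyLE.refl _ _).inter (S.R_subset p)
  · obtain ⟨rfl, -⟩ := (Λ.mem_into _ _ _).1 hp
    refine measure_congr ?_
    filter_upwards [S.R_subset p] with x hx
    exact propext ⟨fun h => ⟨hx h, h⟩, fun h => h.2⟩

end KGraph.SemibranchingSystem

namespace KGraph

variable {k : ℕ} {V : Type u} [SmallCategory V]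

/-! ### Functionals concentrated on the diagonal -/

section Diagonal

variable {Λ : KGraph k V} [Λ.IsFinite]

/-- This projection replaces a unit as the element on which a normalized diagonal functional attains
its norm. -/
theorem norm_sum_range_projections_le (n : Fin k → ℕ) :
    ‖∑ p ∈ Λ.ofDegree n, Λ.gen p * star (Λ.gen p)‖ ≤ 1 := by
  classical
  refine IsStarProjection.norm_le _ ⟨?_, ?_⟩
  · rw [IsIdempotentElem, Finset.sum_mul]
    refine Finset.sum_congr rfl fun p hp => ?_
    rw [Finset.mul_sum, Finset.sum_eq_single p]
    · rw [← mul_assoc, show Λ.gen p * star (Λ.gen p) * Λ.gen p = Λ.gen p from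
        Λ.genFamily.partialIsometry p]
    · intro q hq hqp
      rw [mul_assoc, ← mul_assoc (star (Λ.gen p)), show star (Λ.gen p) * Λ.gen q = 0 from
        Λ.genFamily.star_mul_eq_zero (((Λ.mem_ofDegree n p).1 hp).trans
          ((Λ.mem_ofDegree n q).1 hq).symm) hqp.symm, zero_mul, mul_zero]
    · exact fun h => absurd hp h
  · simp only [IsSelfAdjoint, star_sum, star_mul, star_star]

theorem continuous_gauge (z : Fin k → Circle) : Continuous (Λ.gauge z) :=
  ((Λ.continuous_bigGauge z).comp continuous_subtype_val).subtype_mk _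

theorem gauge_monomial (z : Fin k → Circle) (p q : Λ.Path) :
    Λ.gauge z (Λ.gen p * star (Λ.gen q)) =
      ((torusPow z (Λ.degree p) : ℂ) * star (torusPow z (Λ.degree q) : ℂ)) •
        (Λ.gen p * star (Λ.gen q)) := by
  rw [map_mul, map_star, gauge_gen, gauge_gen, star_smul, smul_mul_smul_comm]

theorem torusPow_exp (x : Fin k → ℝ) (n : Fin k → ℕ) :
    (torusPow (fun i => Circle.exp (x i)) n : ℂ) =
      Complex.exp (Complex.I * ∑ i, (n i : ℂ) * x i) := by
  rw [Finset.mul_sum, Complex.exp_sum, torusPow]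
  refine (map_prod Circle.coeHom _ _).trans ?_
  refine Finset.prod_congr rfl fun i _ => ?_
  change ((Circle.exp (x i) ^ n i : Circle) : ℂ) = _
  rw [Circle.coe_pow, Circle.coe_exp, ← Complex.exp_nat_mul]
  congr 1
  ring

/-- Monomials are eigenvectors of the dynamics, with eigenvalues in a form that continues to complex
time. -/
theorem dynamics_monomial (C : Fin k → ℝ) (t : ℝ) (p q : Λ.Path) :
    Λ.dynamics C t (Λ.gen p * star (Λ.gen q)) =
      Complex.exp (Complex.I * t *
        (∑ i, ((Λ.degree p i : ℝ) - Λ.degree q i) * Real.log (C i) : ℝ)) •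
          (Λ.gen p * star (Λ.gen q)) := by
  rw [dynamics, gauge_monomial, torusPow_exp, torusPow_exp, RCLike.star_def, ← Complex.exp_conj,
    ← Complex.exp_add]
  congr 2
  simp only [map_mul, Complex.conj_I, map_sum, Complex.conj_ofReal, Complex.conj_natCast]
  push_cast
  simp only [Finset.mul_sum, ← Finset.sum_add_distrib]
  exact Finset.sum_congr rfl fun i _ => by ring

open scoped Classical in
/-- A functional on `C*(Λ)` is diagonal with weight `w` if `φ(s_p s_q^*) = δ_{p,q} w(p)`. -/
def IsDiagonal (φ : Λ.CStar →L[ℂ] ℂ) (w : Λ.Path → ℝ) : Prop :=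
  ∀ p q, φ (Λ.gen p * star (Λ.gen q)) = if p = q then (w p : ℂ) else 0

/-! ### Symmetries and twisted trace identities of diagonal functionals -/

namespace IsDiagonal

variable {φ : Λ.CStar →L[ℂ] ℂ} {w : Λ.Path → ℝ}

theorem map_self (hφ : IsDiagonal φ w) (p : Λ.Path) : φ (Λ.gen p * star (Λ.gen p)) = w p := by
  rw [hφ, if_pos rfl]

theorem map_of_ne (hφ : IsDiagonal φ w) {p q : Λ.Path} (h : p ≠ q) :
    φ (Λ.gen p * star (Λ.gen q)) = 0 := by
  rw [hφ, if_neg h]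

theorem eq (hφ : IsDiagonal φ w) {ψ : Λ.CStar →L[ℂ] ℂ} (hψ : IsDiagonal ψ w) : φ = ψ :=
  CStar.clm_ext fun p q => (hφ p q).trans (hψ p q).symm

theorem norm_eq_one (hφ : IsDiagonal φ w) (h : ‖φ‖ ≤ 1) {n : Fin k → ℕ}
    (hw : ∑ p ∈ Λ.ofDegree n, w p = 1) : ‖φ‖ = 1 := by
  refine le_antisymm h ?_
  have h1 : φ (∑ p ∈ Λ.ofDegree n, Λ.gen p * star (Λ.gen p)) = 1 := by
    rw [map_sum, Finset.sum_congr rfl fun p _ => hφ.map_self p]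
    exact_mod_cast hw
  have h2 := φ.le_opNorm (∑ p ∈ Λ.ofDegree n, Λ.gen p * star (Λ.gen p))
  rw [h1, norm_one] at h2
  exact h2.trans (mul_le_of_le_one_right (norm_nonneg _) (norm_sum_range_projections_le n))

theorem map_star (hφ : IsDiagonal φ w) (a : Λ.CStar) : φ (star a) = star (φ a) := by
  refine congrFun (Continuous.ext_on Λ.dense_monomialSpan (f := fun a => φ (star a))
    (g := fun a => star (φ a)) (by fun_prop) (by fun_prop) fun a ha => ?_) a
  induction ha using Submodule.span_induction with
  | mem x hx =>
    obtain ⟨⟨p, q⟩, rfl⟩ := hx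
    simp only [star_mul, star_star]
    by_cases h : p = q
    · rw [h, hφ.map_self, RCLike.star_def, Complex.conj_ofReal]
    · rw [hφ.map_of_ne h, hφ.map_of_ne (Ne.symm h), star_zero]
  | zero => simp
  | add x y _ _ hx hy => simp only [star_add, map_add] at hx hy ⊢; rw [hx, hy]
  | smul c x _ hx => simp only [star_smul, map_smul, smul_eq_mul, star_mul'] at hx ⊢; rw [hx]

/-- The gauge action fixes the diagonal monomials and rescales the others, which `φ` kills. -/
theorem map_gauge (hφ : IsDiagonal φ w) (z : Fin k → Circle) (a : Λ.CStar) :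
    φ (Λ.gauge z a) = φ a := by
  let γ : Λ.CStar →L[ℂ] Λ.CStar :=
    { toFun := Λ.gauge z
      map_add' := map_add _
      map_smul' := map_smul _
      cont := continuous_gauge z }
  refine DFunLike.congr_fun (CStar.clm_ext (φ := φ.comp γ) (ψ := φ) fun p q => ?_) a
  change φ (Λ.gauge z (Λ.gen p * star (Λ.gen q))) = _
  rw [gauge_monomial, map_smul, smul_eq_mul]
  by_cases h : p = q
  · rw [h, mul_comm (torusPow z _ : ℂ), star_torusPow_mul_self, one_mul]
  · rw [hφ.map_of_ne h, mul_zero]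

/-- It suffices to test `b = s_q s_e^*`, and lengthening reduces to `d(p) ≤ d(e)`. Writing `e = a
b'` with `d(a) = d(p)`, both sides vanish unless `a = p` and `q = b'`; in that case they are `w(pq)`
and `κ w(q)`. -/
theorem map_gen_mul (hφ : IsDiagonal φ w) {p : Λ.Path} {κ : ℝ}
    (hw : ∀ q : Λ.Path, q.r = p.s → w (p.append q) = κ * w q) (b : Λ.CStar) :
    φ (Λ.gen p * b) = κ * φ (b * Λ.gen p) := by
  classical
  suffices h : ∀ q e : Λ.Path, φ (Λ.gen p * (Λ.gen q * star (Λ.gen e))) =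
      κ * φ (Λ.gen q * star (Λ.gen e) * Λ.gen p) from
    DFunLike.congr_fun (CStar.clm_ext (φ := φ.comp (ContinuousLinearMap.mul ℂ Λ.CStar (Λ.gen p)))
      (ψ := (κ : ℂ) • φ.comp ((ContinuousLinearMap.mul ℂ Λ.CStar).flip (Λ.gen p))) h) b
  have key : ∀ q e : Λ.Path, Λ.degree p ≤ Λ.degree e →
      φ (Λ.gen p * (Λ.gen q * star (Λ.gen e))) =
        κ * φ (Λ.gen q * star (Λ.gen e) * Λ.gen p) := by
    intro q e hd
    obtain ⟨a, b, hab, rfl, ha, -⟩ := Path.exists_eq_append_of_le hd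
    rw [mul_assoc, show star (Λ.gen (a.append b)) * Λ.gen p =
      if a = p then star (Λ.gen b) else 0 from Λ.genFamily.star_append_mul hab ha, ← mul_assoc]
    by_cases hq : q.r = p.s
    · rw [show Λ.gen p * Λ.gen q = Λ.gen (p.append q) from Λ.genFamily.mul_append hq]
      by_cases h : a = p ∧ q = b
      · obtain ⟨rfl, rfl⟩ := h
        rw [if_pos rfl, hφ.map_self, hφ.map_self, hw q hq, Complex.ofReal_mul]
      · rw [hφ.map_of_ne fun h' => h ?_]
        · split_ifs with hap
          · rw [hφ.map_of_ne fun hqb => h ⟨hap, hqb⟩, mul_zero]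
          · rw [mul_zero, map_zero, mul_zero]
        · obtain ⟨h1, h2⟩ := Path.append_inj hq hab ha.symm h'
          exact ⟨h1.symm, h2⟩
    · rw [show Λ.gen p * Λ.gen q = 0 from Λ.genFamily.mul_eq_zero hq, zero_mul, map_zero]
      split_ifs with hap
      · rw [hφ.map_of_ne, mul_zero]
        rintro rfl
        exact hq (hap ▸ hab)
      · rw [mul_zero, map_zero, mul_zero]
  intro q e
  by_cases h : q.s = e.s
  · rw [show Λ.gen q * star (Λ.gen e) = ∑ f ∈ Λ.into q.s (Λ.degree p),
      Λ.gen (q.append f) * star (Λ.gen (e.append f)) from Λ.genFamily.mul_star_eq_sum q e h _,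
      Finset.mul_sum, Finset.sum_mul, map_sum, map_sum, Finset.mul_sum]
    refine Finset.sum_congr rfl fun f hf => key _ _ ?_
    obtain ⟨h1, h2⟩ := (Λ.mem_into _ _ _).1 hf
    rw [Path.degree_append (h1.trans h), h2]
    exact le_add_self
  · rw [show Λ.gen q * star (Λ.gen e) = 0 from Λ.genFamily.mul_star_eq_zero h, mul_zero, zero_mul,
      map_zero, mul_zero]

/-- The adjoint of the identity for `s_p`, since `φ` is hermitian and `κ` is real. -/
theorem map_star_gen_mul (hφ : IsDiagonal φ w) {p : Λ.Path} {κ : ℝ} (hκ : κ ≠ 0)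
    (hw : ∀ q : Λ.Path, q.r = p.s → w (p.append q) = κ * w q) (b : Λ.CStar) :
    φ (star (Λ.gen p) * b) = κ⁻¹ * φ (b * star (Λ.gen p)) := by
  have h := congrArg star (hφ.map_gen_mul hw (star b))
  rw [← hφ.map_star, star_mul', ← hφ.map_star, RCLike.star_def, Complex.conj_ofReal, star_mul,
    star_mul, star_star] at h
  rw [h, Complex.ofReal_inv, inv_mul_cancel_left₀ (by exact_mod_cast hκ)]

theorem map_monomial_mul (hφ : IsDiagonal φ w) {κ : Λ.Path → ℝ} (hκ : ∀ p, κ p ≠ 0)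
    (hw : ∀ p q : Λ.Path, q.r = p.s → w (p.append q) = κ p * w q) (p q : Λ.Path) (b : Λ.CStar) :
    φ (Λ.gen p * star (Λ.gen q) * b) =
      (κ p / κ q : ℝ) * φ (b * (Λ.gen p * star (Λ.gen q))) := by
  rw [mul_assoc, hφ.map_gen_mul (hw p), mul_assoc, hφ.map_star_gen_mul (hκ q) (hw q), mul_assoc,
    ← mul_assoc, div_eq_mul_inv]
  push_cast
  rfl

end IsDiagonal

end Diagonal

/-! ### Analytic continuation and the KMS condition -/

theorem _root_.Differentiable.eq_of_eqOn_real {f g : ℂ → ℂ} (hf : Differentiable ℂ f)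
    (hg : Differentiable ℂ g) (h : ∀ t : ℝ, f t = g t) : f = g := by
  refine AnalyticOnNhd.eq_of_frequently_eq (z₀ := 0) (fun z _ => hf.analyticAt z)
    (fun z _ => hg.analyticAt z) ?_
  have h1 : Filter.Tendsto ((↑) : ℝ → ℂ) (nhdsWithin 0 {0}ᶜ) (nhdsWithin 0 {0}ᶜ) := by
    refine tendsto_nhdsWithin_iff.2 ⟨?_, ?_⟩
    · exact (Complex.continuous_ofReal.tendsto' 0 0 rfl).mono_left nhdsWithin_le_nhds
    · filter_upwards [self_mem_nhdsWithin] with t ht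
      simpa using ht
  exact h1.frequently (Filter.Frequently.of_forall h)

section KMS

variable {Λ : KGraph k V} [Λ.IsFinite] {φ : Λ.CStar →L[ℂ] ℂ} {w : Λ.Path → ℝ}

/-- The scaling factor `C^{-ω n}`. -/
noncomputable def scale (C : Fin k → ℝ) (ω : ℝ) (n : Fin k → ℕ) : ℝ :=
  ∏ i, C i ^ (-(ω * (n i : ℝ)))

theorem scale_eq_exp {C : Fin k → ℝ} (hC : ∀ i, 0 < C i) (ω : ℝ) (n : Fin k → ℕ) :
    scale C ω n = Real.exp (-ω * ∑ i, (n i : ℝ) * Real.log (C i)) := by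
  rw [scale, Finset.mul_sum, Real.exp_sum]
  refine Finset.prod_congr rfl fun i _ => ?_
  rw [Real.rpow_def_of_pos (hC i)]
  congr 1
  ring

theorem scale_pos {C : Fin k → ℝ} (hC : ∀ i, 0 < C i) (ω : ℝ) (n : Fin k → ℕ) :
    0 < scale C ω n := Finset.prod_pos fun i _ => Real.rpow_pos_of_pos (hC i) _

theorem scale_add {C : Fin k → ℝ} (hC : ∀ i, 0 < C i) (ω : ℝ) (m n : Fin k → ℕ) :
    scale C ω (m + n) = scale C ω m * scale C ω n := by
  simp only [scale, ← Finset.prod_mul_distrib]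
  refine Finset.prod_congr rfl fun i _ => ?_
  rw [← Real.rpow_add (hC i), Pi.add_apply]
  congr 1
  push_cast
  ring

/-- By density `b` may be a monomial. Only `a` needs continuation: the eigenvalue of the monomial
under the dynamics is explicit. -/
theorem IsDiagonal.map_mul_entireExtension (hφ : IsDiagonal φ w) {C : Fin k → ℝ}
    (hC : ∀ i, 0 < C i) {ω : ℝ}
    (hw : ∀ p q : Λ.Path, q.r = p.s → w (p.append q) = scale C ω (Λ.degree p) * w q)
    {a : Λ.CStar} {F : ℂ → Λ.CStar} (hF : IsEntireExtension (Λ.dynamics C) a F) (b : Λ.CStar) :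
    φ (a * b) = φ (b * F (Complex.I * ω)) := by
  refine DFunLike.congr_fun (CStar.clm_ext (φ := φ.comp (ContinuousLinearMap.mul ℂ Λ.CStar a))
    (ψ := φ.comp ((ContinuousLinearMap.mul ℂ Λ.CStar).flip (F (Complex.I * ω))))
    fun p q => ?_) b
  change φ (a * (Λ.gen p * star (Λ.gen q))) = φ (Λ.gen p * star (Λ.gen q) * F (Complex.I * ω))
  set θ : ℝ := ∑ i, ((Λ.degree p i : ℝ) - Λ.degree q i) * Real.log (C i) with hθ
  -- For real `z` this is `φ` of the dynamics at time `z` applied to `s_p s_q^* a`. By gauge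
  -- invariance it is constant on the real line, hence on `ℂ`.
  let G : ℂ → ℂ := fun z =>
    Complex.exp (Complex.I * z * θ) * φ (Λ.gen p * star (Λ.gen q) * F z)
  have hG : Differentiable ℂ G := by
    have h1 : Differentiable ℂ fun z => φ (Λ.gen p * star (Λ.gen q) * F z) :=
      (φ.comp (ContinuousLinearMap.mul ℂ Λ.CStar (Λ.gen p * star (Λ.gen q)))).differentiable.comp
        hF.1
    exact Differentiable.mul (by fun_prop) h1
  have hGc := hG.eq_of_eqOn_real (g := fun _ => φ (Λ.gen p * star (Λ.gen q) * a))
    (differentiable_const _) fun t => by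
      simp only [G]
      rw [hF.2 t, ← smul_eq_mul, ← map_smul, ← smul_mul_assoc, ← dynamics_monomial, ← map_mul]
      exact hφ.map_gauge _ _
  have h1 := congrFun hGc (Complex.I * ω)
  simp only [G] at h1
  -- At `z = iω` the eigenvalue is `e^{-ωθ}`, exactly the factor in the twisted trace identity, so
  -- the two cancel.
  have hexp : Complex.exp (Complex.I * (Complex.I * ω) * θ) =
      ((scale C ω (Λ.degree p) / scale C ω (Λ.degree q) : ℝ) : ℂ) := by
    rw [scale_eq_exp hC, scale_eq_exp hC, ← Real.exp_sub, Complex.ofReal_exp]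
    congr 1
    rw [← mul_assoc, Complex.I_mul_I, ← mul_sub, ← Finset.sum_sub_distrib, hθ]
    simp only [sub_mul]
    push_cast
    ring
  rw [hφ.map_monomial_mul (fun p => (scale_pos hC ω (Λ.degree p)).ne') hw p q a, hexp] at h1
  refine (mul_left_cancel₀ ?_ h1).symm
  rw [← hexp]
  exact Complex.exp_ne_zero _

end KMS

end KGraph

/-! ### The weights given by the measures of the ranges, and the conclusion -/

open scoped Classical in
theorem mainTheorem3 {k : ℕ} {V : Type u} [SmallCategory V] (Λ : KGraph k V) [Λ.IsFinite]
    (hΛ : Λ.NoSources)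
    {X : Type*} [MeasurableSpace X] (μ : Measure X) [IsProbabilityMeasure μ]
    (S : Λ.SemibranchingSystem μ)
    (ω : ℝ) (hω : 0 < ω) (C : Fin k → ℝ) (hC : ∀ i, 0 < C i)
    (hΦ : ∀ p : Λ.Path, IsRNDerivOn μ (S.D p) (S.τ p)
      (fun _ => ENNReal.ofReal (∏ i, C i ^ (-(ω * (Λ.degree p i : ℝ)))))) :
    ∃ φ : Λ.CStar →L[ℂ] ℂ,
      (∀ p q : Λ.Path,
        φ (Λ.gen p * star (Λ.gen q)) = if p = q then ((μ.real (S.R p) : ℝ) : ℂ) else 0) ∧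
      IsKMSState (Λ.dynamics C) ω φ ∧
      ∀ ψ : Λ.CStar →L[ℂ] ℂ,
        (∀ p q : Λ.Path,
          ψ (Λ.gen p * star (Λ.gen q)) = if p = q then ((μ.real (S.R p) : ℝ) : ℂ) else 0) →
        ψ = φ := by
  have hR : ∀ p : Λ.Path, μ.real (S.R p) =
      KGraph.scale C ω (Λ.degree p) * μ.real (S.R (Λ.vertex p.s)) := fun p => by
    rw [Measure.real, S.measure_R_of_isRNDerivOn_const
      (c := ENNReal.ofReal (KGraph.scale C ω (Λ.degree p))) (hΦ p), ENNReal.toReal_mul,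
      ENNReal.toReal_ofReal (KGraph.scale_pos hC ω _).le]
    simp only [Measure.real]
  have hscale : ∀ p q : Λ.Path, q.r = p.s →
      μ.real (S.R (p.append q)) = KGraph.scale C ω (Λ.degree p) * μ.real (S.R q) :=
    fun p q h => by
      rw [hR, hR q, KGraph.Path.degree_append h, KGraph.Path.append_s h, KGraph.scale_add hC,
        mul_assoc]
  have hsum : ∀ n, ∑ p ∈ Λ.ofDegree n, μ.real (S.R p) = 1 := fun n => by
    simp only [Measure.real]
    rw [← ENNReal.toReal_sum fun p _ => measure_ne_top μ _, S.sum_measure_R, measure_univ,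
      ENNReal.toReal_one]
  -- The partition of the domain of the source vertex of `p`, rescaled by `C^{-ω d(p)}`.
  have hw : ∀ (p : Λ.Path) (n), μ.real (S.R p) =
      ∑ e ∈ Λ.into p.s n, μ.real (S.R (p.append e)) := fun p n => by
    rw [hR, Measure.real, S.measure_R_vertex_eq_sum _ n,
      ENNReal.toReal_sum fun p _ => measure_ne_top μ _, Finset.mul_sum]
    exact Finset.sum_congr rfl fun e he => (hscale p e ((Λ.mem_into _ _ _).1 he).1).symm
  obtain ⟨φ, hφ1, hφpos, hφ⟩ := KGraph.exists_functional_of_weight hΛ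
    (fun p => μ.real (S.R p)) (fun _ => measureReal_nonneg) hw hsum
  have hφ : KGraph.IsDiagonal φ fun p => μ.real (S.R p) := hφ
  -- Any degree would do for the normalization; degree zero uses the sum of the vertex projections.
  refine ⟨φ, hφ, ⟨⟨hφpos, hφ.norm_eq_one hφ1 (hsum 0)⟩, fun a b F _ hF _ => ?_⟩,
    fun ψ hψ => KGraph.IsDiagonal.eq (w := fun p => μ.real (S.R p)) hψ hφ⟩
  exact hφ.map_mul_entireExtension hC hscale hF b
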